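/- Let $k\ge 3$ be an integer. A $k$-graph $H=(V,E)$ consists of a vertex set $V$ and a set $E$ of $k$-element subsets of $V$, called edges. For a $k$-graph $F$, let $\mathrm{ex}(n,F)$ be the maximum number of edges in a $k$-graph on $n$ vertices that contains no copy of $F$ as a (not necessarily induced) subgraph, and let $$\pi(F)=\lim_{n\to\infty}\frac{\mathrm{ex}(n,F)}{\binom{n}{k}}$$ be the Turán density of $F$ (this limit always exists). Let $K_\ell^{(k)}$ be the complete $k$-graph on $\ell$ vertices, whose edges are all $k$-element subsets of its vertex set, and let $K_\ell^{(k)-}$ be the $k$-graph obtained from $K_\ell^{(k)}$ by deleting one edge (up to isomorphism, the choice of the edge does not matter). Then, for every integer $k\ge 3$, $$\pi\bigl(K_{k+1}^{(k)}\bigr)<\pi\bigl(K_{k+2}^{(k)-}\bigr).$$ -/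

import Mathlib

open Filter Topology

/-- A `k`-uniform hypergraph (`k`-graph) on the vertex type `V`: a finite set of edges, each of
which is a set of exactly `k` vertices. -/
structure KGraph (k : ℕ) (V : Type*) where
  edges : Finset (Finset V)
  card_eq : ∀ e ∈ edges, e.card = k

namespace KGraph

variable {k : ℕ} {V W : Type*}

/-- `H` contains a copy of `F`: some injection of the vertices of `F` into the vertices of `H`
maps every edge of `F` to an edge of `H`. -/
def Contains (H : KGraph k W) (F : KGraph k V) : Prop :=
  ∃ f : V ↪ W, ∀ e ∈ F.edges, e.map f ∈ H.edges

/-- `H` is `F`-free: it contains no (not necessarily induced) copy of `F`. -/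
def Free (H : KGraph k W) (F : KGraph k V) : Prop :=
  ¬ H.Contains F

/-- The Turán number `ex(n, F)`: the maximum number of edges of an `F`-free `k`-graph on `n`
vertices. -/
noncomputable def ex (n : ℕ) (F : KGraph k V) : ℕ :=
  sSup {m : ℕ | ∃ H : KGraph k (Fin n), H.Free F ∧ H.edges.card = m}

/-- The Turán density `π(F) = lim_{n → ∞} ex(n, F) / (n choose k)`. The limit exists, see
`tendsto_turanDensity`. -/
noncomputable def turanDensity (F : KGraph k V) : ℝ :=
  limUnder atTop (fun n : ℕ => (ex n F : ℝ) / (n.choose k : ℝ))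

/-- The complete `k`-graph `K_ℓ^{(k)}` on `ℓ` vertices. -/
def complete (k l : ℕ) : KGraph k (Fin l) where
  edges := (Finset.univ : Finset (Fin l)).powersetCard k
  card_eq := fun _ he => (Finset.mem_powersetCard.mp he).2

/-- The `k`-graph `H` minus the edge `e`, on the same vertex set. -/
def deleteEdge [DecidableEq V] (H : KGraph k V) (e : Finset V) : KGraph k V where
  edges := H.edges.erase e
  card_eq := fun _ hd => H.card_eq _ (Finset.mem_of_mem_erase hd)

/-! ### The maximum in `ex` and the limit in `turanDensity` exist -/

theorem card_edges_le {n : ℕ} (H : KGraph k (Fin n)) : H.edges.card ≤ n.choose k := by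
  have h : H.edges ⊆ (Finset.univ : Finset (Fin n)).powersetCard k := fun e he =>
    Finset.mem_powersetCard.mpr ⟨Finset.subset_univ _, H.card_eq e he⟩
  simpa using Finset.card_le_card h

theorem le_ex {n : ℕ} {F : KGraph k V} {H : KGraph k (Fin n)} (h : H.Free F) :
    H.edges.card ≤ ex n F :=
  le_csSup ⟨n.choose k, by rintro _ ⟨H', -, rfl⟩; exact H'.card_edges_le⟩ ⟨H, h, rfl⟩

theorem ex_le {n m : ℕ} {F : KGraph k V}
    (h : ∀ H : KGraph k (Fin n), H.Free F → H.edges.card ≤ m) : ex n F ≤ m :=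
  csSup_le' (by rintro _ ⟨H, hH, rfl⟩; exact h H hH)

theorem ex_succ_mul_le (n : ℕ) (F : KGraph k V) :
    ex (n + 1) F * (n + 1 - k) ≤ ex n F * (n + 1) := by
  classical
  rcases (Nat.eq_zero_or_pos (n + 1 - k)) with h0 | hpos
  · simp [h0]
  rw [← Nat.le_div_iff_mul_le hpos]
  refine ex_le fun H hH => ?_
  rw [Nat.le_div_iff_mul_le hpos]
  have key : ∀ v : Fin (n + 1), (H.edges.filter (fun e => v ∉ e)).card ≤ ex n F := by
    intro v
    let s := Fin.succAboveEmb v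
    let H' : KGraph k (Fin n) :=
      { edges := Finset.univ.filter (fun e : Finset (Fin n) => e.map s ∈ H.edges)
        card_eq := fun e he => by
          have := H.card_eq _ (Finset.mem_filter.mp he).2
          simpa using this }
    have hfree : H'.Free F := by
      rintro ⟨f, hf⟩
      refine hH ⟨f.trans s, fun e he => ?_⟩
      have := (Finset.mem_filter.mp (hf e he)).2
      rwa [Finset.map_map] at this
    refine le_trans ?_ (le_ex hfree)
    have hsub : H.edges.filter (fun e => v ∉ e) ⊆
        H'.edges.image (fun e => e.map s) := by
      intro e he
      obtain ⟨he, hv⟩ := Finset.mem_filter.mp he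
      have hmap : (Finset.univ.filter (fun i => v.succAbove i ∈ e)).map s = e := by
        ext w
        simp only [Finset.mem_map, Finset.mem_filter, Finset.mem_univ, true_and]
        constructor
        · rintro ⟨i, hi, rfl⟩
          exact hi
        · intro hw
          obtain ⟨i, rfl⟩ := Fin.exists_succAbove_eq (x := w) (y := v) (by rintro rfl; exact hv hw)
          exact ⟨i, hw, rfl⟩
      exact Finset.mem_image.mpr ⟨_, Finset.mem_filter.mpr ⟨Finset.mem_univ _, by rwa [hmap]⟩, hmap⟩
    exact (Finset.card_le_card hsub).trans Finset.card_image_le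
  calc H.edges.card * (n + 1 - k)
      = ∑ e ∈ H.edges, (Finset.univ.filter (fun v : Fin (n + 1) => v ∉ e)).card := by
        rw [Finset.sum_const_nat]
        intro e he
        have : Finset.univ.filter (fun v : Fin (n + 1) => v ∉ e) = eᶜ := by ext; simp
        rw [this, Finset.card_compl, H.card_eq e he, Fintype.card_fin]
    _ = ∑ v : Fin (n + 1), (H.edges.filter (fun e => v ∉ e)).card := by
        simp only [Finset.card_filter]
        exact Finset.sum_comm
    _ ≤ ∑ _v : Fin (n + 1), ex n F := Finset.sum_le_sum fun v _ => key v
    _ = ex n F * (n + 1) := by simp [mul_comm]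

/-- The limit in the definition of the Turán density exists. -/
theorem tendsto_turanDensity (F : KGraph k V) :
    Tendsto (fun n : ℕ => (ex n F : ℝ) / (n.choose k : ℝ)) atTop (𝓝 (turanDensity F)) := by
  refine tendsto_nhds_limUnder ?_
  have hanti : Antitone fun n : ℕ => (ex (n + k) F : ℝ) / ((n + k).choose k : ℝ) := by
    refine antitone_nat_of_succ_le fun n => ?_
    have h1 := ex_succ_mul_le (n + k) F
    have h2 := Nat.choose_mul_succ_eq (n + k) k
    have h3 : n + k + 1 - k = n + 1 := by omega
    rw [h3] at h1 h2
    have c1 : (0 : ℝ) < ((n + k).choose k : ℝ) := by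
      exact_mod_cast Nat.choose_pos (Nat.le_add_left k n)
    have c2 : (0 : ℝ) < ((n + k + 1).choose k : ℝ) := by
      exact_mod_cast Nat.choose_pos (by omega)
    have e : n + 1 + k = n + k + 1 := by omega
    rw [e, div_le_div_iff₀ c2 c1]
    have h1' : (ex (n + k + 1) F : ℝ) * (n + 1) ≤ ex (n + k) F * (n + k + 1) := by
      exact_mod_cast h1
    have h2' : ((n + k).choose k : ℝ) * (n + k + 1) = (n + k + 1).choose k * (n + 1) := by
      exact_mod_cast h2
    have hn : (0 : ℝ) < (n : ℝ) + 1 := by positivity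
    refine le_of_mul_le_mul_right ?_ hn
    calc (ex (n + k + 1) F : ℝ) * (n + k).choose k * (n + 1)
        = (ex (n + k + 1) F : ℝ) * (n + 1) * (n + k).choose k := by ring
      _ ≤ (ex (n + k) F : ℝ) * (n + k + 1) * (n + k).choose k :=
          mul_le_mul_of_nonneg_right h1' c1.le
      _ = ex (n + k) F * ((n + k).choose k * (n + k + 1)) := by ring
      _ = (ex (n + k) F : ℝ) * (n + k + 1).choose k * (n + 1) := by rw [h2']; ring
  have hb : BddBelow (Set.range fun n : ℕ => (ex (n + k) F : ℝ) / ((n + k).choose k : ℝ)) :=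
    ⟨0, by rintro _ ⟨n, rfl⟩; positivity⟩
  exact ⟨_, (tendsto_add_atTop_iff_nat k).mp (tendsto_atTop_ciInf hanti hb)⟩

end KGraph

/-!
The strict inequality comes from adding a single vertex to a nearly extremal graph. Let `H` be a
`K_{k+1}`-free `k`-graph of density close to `π(K_{k+1})`, and let `L` be a `(k-1)`-graph on
(a blow-up of) its vertices. Giving a new vertex the link `L` creates a `K_{k+2}` minus an edge only
if `L` is complete on some `k + 1` vertices on which `H` misses at most one edge
(`KGraph.addVertex_free`). Any two vertices of `K_{k+2}` minus an edge lie in a common edge, so its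
Turán density is at least the density of every weighted graph avoiding it
(`KGraph.tupleDensity_le_turanDensity`, where densities are weights of tuples, so that blow-ups
need no error terms). If the density of `L` exceeds `π(K_{k+1})` by a constant, a small weight on
the new vertex yields a density above `π(K_{k+1})` (`KGraph.turanDensity_lt_of_links`).

It remains to find `L`. The link of a vertex `v` of `H` is a start: it can be chosen as dense as
`H`, and a `k`-set on which it is complete is not an edge of `H`, as `v` would extend it to a
`K_{k+1}`. For `k ≥ 4` there is room for improvement. Take random small sets `P` and `P'` of
vertices, `P` much smaller than `P'`; here these are clones of colours `0` and `1`. Add to the link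
all sets with exactly one vertex in each of `P` and `P'`, and delete the sets with two vertices in
`P`, and those with one vertex in `P` and two in `P'`. If this is complete on `k + 1` vertices,
then at most one of them is in `P`, and then at most one is in `P'`. Omitting either of them leaves
a clique of the original link, so that `H` misses two edges (`KGraph.modifiedLink_valid`). The
additions have density of order `|P| |P'|`, since `π(K_{k+1}) < 1`, and outweigh the deletions, of
order `|P|² + |P| |P'|²` (`KGraph.le_tupleDensity_modifiedLink`).

For `k = 3` a complete tripartite graph `L`, of density `2 / 3`, works: it contains no `K_4`, and
`π(K_4^{(3)}) ≤ 13 / 20` (`KGraph.tupleDensity_three_le`). For the bound, Cauchy-Schwarz for the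
codegrees alone would give `2 / 3`, with equality only if almost all `4`-sets span `0` or `3` edges;
but a `5`-set with seven edges contains a `4`-set with one or two.
-/

/-! ### Weighted means over tuples -/

/-- The mean of `g` over tuples of elements of `W` indexed by `ι`, each entry drawn independently
according to the weight `w`. -/
noncomputable def tupleMean {ι W : Type*} [Fintype ι] [DecidableEq ι] [Fintype W] (w : W → ℝ)
    (g : (ι → W) → ℝ) : ℝ :=
  ∑ f : ι → W, (∏ i, w (f i)) * g f

section tupleMean

variable {ι κ W : Type*} [Fintype ι] [DecidableEq ι] [Fintype κ] [DecidableEq κ] [Fintype W]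
  {w : W → ℝ}

theorem tupleMean_const (hw1 : ∑ u, w u = 1) (c : ℝ) :
    tupleMean w (fun _ : ι → W => c) = c := by
  have h := Finset.prod_univ_sum (fun _ : ι => (Finset.univ : Finset W)) (fun _ u => w u)
  simp only [hw1, Finset.prod_const_one, Fintype.piFinset_univ] at h
  rw [tupleMean, ← Finset.sum_mul, ← h, one_mul]

theorem tupleMean_mono (hw : ∀ u, 0 ≤ w u) {g g' : (ι → W) → ℝ} (h : ∀ f, g f ≤ g' f) :
    tupleMean w g ≤ tupleMean w g' :=
  Finset.sum_le_sum fun f _ => mul_le_mul_of_nonneg_left (h f) (Finset.prod_nonneg fun _ _ => hw _)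

theorem tupleMean_add (g g' : (ι → W) → ℝ) :
    tupleMean w (fun f => g f + g' f) = tupleMean w g + tupleMean w g' := by
  simp [tupleMean, mul_add, Finset.sum_add_distrib]

theorem tupleMean_sub (g g' : (ι → W) → ℝ) :
    tupleMean w (fun f => g f - g' f) = tupleMean w g - tupleMean w g' := by
  simp [tupleMean, mul_sub, Finset.sum_sub_distrib]

theorem tupleMean_const_mul (c : ℝ) (g : (ι → W) → ℝ) :
    tupleMean w (fun f => c * g f) = c * tupleMean w g := by
  simp [tupleMean, Finset.mul_sum, mul_left_comm]

theorem tupleMean_sum {α : Type*} (s : Finset α) (g : α → (ι → W) → ℝ) :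
    tupleMean w (fun f => ∑ a ∈ s, g a f) = ∑ a ∈ s, tupleMean w (g a) := by
  simp only [tupleMean, Finset.mul_sum]
  exact Finset.sum_comm

theorem tupleMean_nonneg (hw : ∀ u, 0 ≤ w u) {g : (ι → W) → ℝ} (h : ∀ f, 0 ≤ g f) :
    0 ≤ tupleMean w g :=
  Finset.sum_nonneg fun f _ => mul_nonneg (Finset.prod_nonneg fun _ _ => hw _) (h f)

theorem exists_tupleMean_le (hw : ∀ u, 0 ≤ w u) (hw1 : ∑ u, w u = 1) (g : (ι → W) → ℝ) :
    ∃ f, tupleMean w g ≤ g f := by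
  have : Nonempty (ι → W) := by
    by_contra hne
    rw [not_nonempty_iff] at hne
    have := tupleMean_const (ι := ι) hw1 1
    simp [tupleMean] at this
  obtain ⟨f, hf⟩ := Finite.exists_max g
  exact ⟨f, (tupleMean_mono hw hf).trans_eq (tupleMean_const hw1 _)⟩

/-- A function of some of the coordinates only has the same mean over the full tuples as over
these coordinates. -/
theorem tupleMean_comp (hw1 : ∑ u, w u = 1) {σ : ι → κ} (hσ : Function.Injective σ)
    (g : (ι → W) → ℝ) : tupleMean w (fun φ : κ → W => g (φ ∘ σ)) = tupleMean w g := by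
  classical
  let e : ι ⊕ {x // x ∉ Set.range σ} ≃ κ :=
    ((Equiv.ofInjective σ hσ).sumCongr (Equiv.refl _)).trans (Equiv.Set.sumCompl (Set.range σ))
  have hl : ∀ i, e (Sum.inl i) = σ i := fun i =>
    Equiv.Set.sumCompl_apply_inl (Set.range σ) _
  let E : (ι → W) × ({x // x ∉ Set.range σ} → W) ≃ (κ → W) :=
    (Equiv.sumArrowEquivProdArrow _ _ _).symm.trans (e.arrowCongr (Equiv.refl W))
  have hE : ∀ p j, E p (e j) = Sum.elim p.1 p.2 j := fun p j => by
    simp [E, Equiv.arrowCongr, Equiv.sumArrowEquivProdArrow]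
  have hEσ : ∀ p, E p ∘ σ = p.1 := fun p => by
    ext i; simp [← hl, hE]
  have hprod : ∀ p, ∏ j, w (E p j) = (∏ i, w (p.1 i)) * ∏ i, w (p.2 i) := fun p => by
    rw [← e.prod_comp, Fintype.prod_sum_type]
    simp [hE]
  have h1 := tupleMean_const (ι := {x // x ∉ Set.range σ}) hw1 1
  simp only [tupleMean, mul_one] at h1 ⊢
  rw [← E.sum_comp, Fintype.sum_prod_type]
  refine Finset.sum_congr rfl fun f _ => ?_
  simp only [hprod, hEσ]
  rw [← mul_one ((∏ i, w (f i)) * g f), ← h1, Finset.mul_sum]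
  exact Finset.sum_congr rfl fun _ _ => by ring

/-- The probability that prescribed coordinates take prescribed values. -/
theorem tupleMean_prescribed (hw1 : ∑ u, w u = 1) (I : Finset ι) (s : ι → W)
    [DecidablePred fun f : ι → W => ∀ i ∈ I, f i = s i] :
    tupleMean w (fun f : ι → W => if ∀ i ∈ I, f i = s i then 1 else 0) = ∏ i ∈ I, w (s i) := by
  classical
  have h := Finset.prod_univ_sum (fun _ : ι => (Finset.univ : Finset W))
    (fun i u => w u * if i ∈ I → u = s i then 1 else 0)
  rw [Fintype.piFinset_univ] at h
  have hind : ∀ f : ι → W, (if ∀ i ∈ I, f i = s i then (1 : ℝ) else 0) =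
      ∏ i, if i ∈ I → f i = s i then 1 else 0 := by
    intro f
    split_ifs with hf
    · exact (Finset.prod_eq_one fun i _ => if_pos (hf i)).symm
    · push Not at hf
      obtain ⟨i, hi, hne⟩ := hf
      exact (Finset.prod_eq_zero (Finset.mem_univ i) (if_neg fun h => hne (h hi))).symm
  calc _ = ∑ f : ι → W, ∏ i, (w (f i) * if i ∈ I → f i = s i then 1 else 0) := by
        refine Finset.sum_congr rfl fun f _ => ?_
        rw [Finset.prod_mul_distrib]
        exact congrArg _ (hind f)
    _ = _ := by
        rw [← h, ← Finset.prod_subset (Finset.subset_univ I)]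
        · exact Finset.prod_congr rfl fun i hi => by simp [hi]
        · intro i _ hi
          simp [hi, hw1]

/-- The last entry of a tuple can be drawn separately. -/
theorem tupleMean_snoc {n : ℕ} (g : (Fin (n + 1) → W) → ℝ) :
    tupleMean w g = tupleMean w fun f : Fin n → W => ∑ u, w u * g (Fin.snoc f u) := by
  simp only [tupleMean]
  rw [← (Fin.snocEquiv fun _ : Fin (n + 1) => W).sum_comp, Fintype.sum_prod_type_right]
  refine Finset.sum_congr rfl fun f _ => ?_
  rw [Finset.mul_sum]
  refine Finset.sum_congr rfl fun u _ => ?_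
  simp only [Fin.snocEquiv, Equiv.coe_fn_mk, Fin.prod_univ_castSucc, Fin.snoc_castSucc,
    Fin.snoc_last]
  ring

theorem sq_tupleMean_le (hw : ∀ u, 0 ≤ w u) (hw1 : ∑ u, w u = 1) (g : (ι → W) → ℝ) :
    tupleMean w g ^ 2 ≤ tupleMean w fun f => g f ^ 2 := by
  set t := tupleMean w g with ht
  have h : 0 ≤ tupleMean w fun f => (g f ^ 2 - 2 * t * g f) + t ^ 2 :=
    tupleMean_nonneg hw fun f => by nlinarith [sq_nonneg (g f - t)]
  rw [tupleMean_add, tupleMean_sub, tupleMean_const_mul, tupleMean_const hw1, ← ht] at h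
  nlinarith

end tupleMean

/-- The density of a family `E` of finite sets under the vertex weight `w`: the weight of the
`k`-tuples whose entries form a member of `E`. If every member of `E` has `k` elements, only
tuples with distinct entries contribute. -/
noncomputable def tupleDensity {W : Type*} [Fintype W] [DecidableEq W] (k : ℕ)
    (E : Finset (Finset W)) (w : W → ℝ) : ℝ :=
  tupleMean w fun f : Fin k → W => if Finset.univ.image f ∈ E then 1 else 0

/-- The tuple density is `k!` times the Lagrangian polynomial. -/
theorem tupleDensity_eq {W : Type*} [Fintype W] [DecidableEq W] {k : ℕ}
    {E : Finset (Finset W)} (hE : ∀ e ∈ E, e.card = k) (w : W → ℝ) :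
    tupleDensity k E w = k.factorial * ∑ e ∈ E, ∏ u ∈ e, w u := by
  have h1 : ∀ f : Fin k → W, (∏ i, w (f i)) * (if Finset.univ.image f ∈ E then (1 : ℝ) else 0) =
      ∑ e ∈ E, if Finset.univ.image f = e then ∏ u ∈ e, w u else 0 := by
    intro f
    rw [Finset.sum_ite_eq]
    split_ifs with h
    · have hinj : Set.InjOn f (Finset.univ : Finset (Fin k)) := by
        rw [← Finset.card_image_iff, hE _ h, Finset.card_univ, Fintype.card_fin]
      rw [Finset.prod_image hinj, mul_one]
    · simp
  rw [tupleDensity, tupleMean, Finset.sum_congr rfl fun f _ => h1 f, Finset.sum_comm,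
    Finset.mul_sum]
  refine Finset.sum_congr rfl fun e he => ?_
  rw [← Finset.sum_filter, Finset.sum_const, nsmul_eq_mul]
  congr 2
  have hcard : Fintype.card (Fin k) = Fintype.card e := by simp [hE e he]
  have heq : Fintype.card (Fin k ≃ e) = k.factorial := by
    rw [Fintype.card_equiv (Fintype.equivOfCardEq hcard), Fintype.card_fin]
  rw [← heq, ← Finset.card_univ]
  symm
  refine Finset.card_bij (fun g _ i => (g i : W)) ?_ ?_ ?_
  · intro g _
    simp only [Finset.mem_filter, Finset.mem_univ, true_and]
    ext u
    simp only [Finset.mem_image, Finset.mem_univ, true_and]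
    exact ⟨by rintro ⟨i, rfl⟩; exact (g i).2, fun hu => ⟨g.symm ⟨u, hu⟩, by simp⟩⟩
  · intro g _ g' _ h
    ext i
    exact congrFun h i
  · intro f hf
    simp only [Finset.mem_filter, Finset.mem_univ, true_and] at hf
    have hmem : ∀ i, f i ∈ e := fun i => hf ▸ Finset.mem_image_of_mem _ (Finset.mem_univ i)
    have hsurj : Function.Surjective fun i => (⟨f i, hmem i⟩ : e) := by
      rintro ⟨u, hu⟩
      rw [← hf] at hu
      obtain ⟨i, -, hi⟩ := Finset.mem_image.mp hu
      exact ⟨i, Subtype.ext hi⟩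
    exact ⟨Equiv.ofBijective _ ((Fintype.bijective_iff_surjective_and_card _).mpr ⟨hsurj, hcard⟩),
      Finset.mem_univ _, rfl⟩

/-! ### Blow-ups -/

namespace KGraph

variable {k : ℕ} {V W : Type*}

/-- The blow-up of `G` along `φ`: the `k`-sets which `φ` maps injectively onto an edge of `G`. -/
def comap [Fintype V] [DecidableEq V] [DecidableEq W] (φ : V → W) (G : KGraph k W) :
    KGraph k V where
  edges := Finset.univ.filter fun T => T.card = k ∧ T.image φ ∈ G.edges
  card_eq := fun _ he => (Finset.mem_filter.mp he).2.1

theorem mem_comap [Fintype V] [DecidableEq V] [DecidableEq W] {φ : V → W} {G : KGraph k W}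
    {T : Finset V} : T ∈ (G.comap φ).edges ↔ T.card = k ∧ T.image φ ∈ G.edges := by
  simp [comap]

theorem injOn_of_mem_comap [Fintype V] [DecidableEq V] [DecidableEq W] {φ : V → W}
    {G : KGraph k W} {T : Finset V} (h : T ∈ (G.comap φ).edges) : Set.InjOn φ T := by
  rw [mem_comap] at h
  rw [← Finset.card_image_iff, G.card_eq _ h.2, h.1]

/-- If any two vertices of `F` lie in a common edge, then blow-ups of `F`-free `k`-graphs are
`F`-free. -/
theorem Free.comap {U : Type*} [Fintype V] [DecidableEq V] [DecidableEq W] {F : KGraph k U}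
    (hF : ∀ a b : U, a ≠ b → ∃ e ∈ F.edges, a ∈ e ∧ b ∈ e) {G : KGraph k W} (hG : G.Free F)
    (φ : V → W) : (G.comap φ).Free F := by
  rintro ⟨f, hf⟩
  have hinj : Function.Injective (φ ∘ f) := by
    intro a b hab
    by_contra hne
    obtain ⟨e, he, ha, hb⟩ := hF a b hne
    exact hne (f.injective (injOn_of_mem_comap (hf e he) (by simpa using ha) (by simpa using hb)
      hab))
  refine hG ⟨⟨φ ∘ f, hinj⟩, fun e he => ?_⟩
  have h := (mem_comap.mp (hf e he)).2
  rw [Finset.map_eq_image, Finset.image_image] at h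
  rw [Finset.map_eq_image]
  exact h

theorem choose_mul_tupleDensity_le_ex {U : Type*} [Fintype W] [DecidableEq W] {F : KGraph k U}
    (hF : ∀ a b : U, a ≠ b → ∃ e ∈ F.edges, a ∈ e ∧ b ∈ e) {G : KGraph k W} (hG : G.Free F)
    {w : W → ℝ} (hw : ∀ u, 0 ≤ w u) (hw1 : ∑ u, w u = 1) (N : ℕ) :
    N.choose k * tupleDensity k G.edges w ≤ ex N F := by
  -- The left side is the mean number of edges of the blow-up along a random map.
  obtain ⟨φ, hφ⟩ := exists_tupleMean_le (ι := Fin N) hw hw1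
    (fun φ => ∑ T ∈ Finset.univ.powersetCard k, if T.image φ ∈ G.edges then 1 else 0)
  have hcard : ∑ T ∈ (Finset.univ : Finset (Fin N)).powersetCard k,
      (if T.image φ ∈ G.edges then (1 : ℝ) else 0) = (G.comap φ).edges.card := by
    rw [Finset.sum_boole]
    congr 2
    ext T
    simp [mem_comap, Finset.mem_powersetCard]
  rw [hcard, tupleMean_sum] at hφ
  refine le_trans (le_of_eq ?_) (hφ.trans (by exact_mod_cast le_ex (hG.comap hF φ)))
  rw [Finset.sum_congr rfl (g := fun _ => tupleDensity k G.edges w)]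
  · simp
  · intro T hT
    have hT := (Finset.mem_powersetCard.mp hT).2
    rw [tupleDensity, ← tupleMean_comp hw1 (T.orderEmbOfFin hT).injective]
    congr 1
    ext φ
    rw [← Finset.image_image, Finset.image_orderEmbOfFin_univ]

/-- Blowing up an `F`-free weighted `k`-graph bounds the Turán density of `F` from below. -/
theorem tupleDensity_le_turanDensity {U : Type*} [Fintype W] [DecidableEq W] {F : KGraph k U}
    (hF : ∀ a b : U, a ≠ b → ∃ e ∈ F.edges, a ∈ e ∧ b ∈ e) {G : KGraph k W} (hG : G.Free F)
    {w : W → ℝ} (hw : ∀ u, 0 ≤ w u) (hw1 : ∑ u, w u = 1) :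
    tupleDensity k G.edges w ≤ F.turanDensity := by
  refine ge_of_tendsto (tendsto_turanDensity F) ?_
  filter_upwards [eventually_ge_atTop k] with N hN
  have hpos : (0 : ℝ) < N.choose k := by exact_mod_cast Nat.choose_pos hN
  rw [le_div_iff₀ hpos, mul_comm]
  exact choose_mul_tupleDensity_le_ex hF hG hw hw1 N

theorem exists_card_eq_ex (n : ℕ) {F : KGraph k V} (hF : F.edges.Nonempty) :
    ∃ H : KGraph k (Fin n), H.Free F ∧ H.edges.card = ex n F := by
  refine Nat.sSup_mem (s := {m : ℕ | ∃ H : KGraph k (Fin n), H.Free F ∧ H.edges.card = m})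
    ⟨0, ⟨∅, by simp⟩, ?_, rfl⟩ ⟨n.choose k, by rintro _ ⟨H', -, rfl⟩; exact H'.card_edges_le⟩
  rintro ⟨f, hf⟩
  obtain ⟨e, he⟩ := hF
  simpa using hf e he

/-! ### Uniform weights -/

theorem tupleDensity_uniform {n : ℕ} (H : KGraph k (Fin n)) :
    tupleDensity k H.edges (fun _ => (n : ℝ)⁻¹) = k.factorial * H.edges.card / n ^ k := by
  rw [tupleDensity_eq H.card_eq, Finset.sum_congr rfl
    (g := fun _ => ((n : ℝ)⁻¹) ^ k) fun e he => by rw [Finset.prod_const, H.card_eq e he]]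
  rw [Finset.sum_const, nsmul_eq_mul, inv_pow]
  ring

theorem tendsto_descFactorial_div_pow (r : ℕ) :
    Tendsto (fun n : ℕ => (n.descFactorial r : ℝ) / n ^ r) atTop (𝓝 1) := by
  refine (Asymptotics.isEquivalent_iff_tendsto_one ?_).mp (isEquivalent_descFactorial r)
  filter_upwards [eventually_gt_atTop 0] with n hn
  positivity

theorem tendsto_ex_div_pow (F : KGraph k V) :
    Tendsto (fun n : ℕ => (k.factorial : ℝ) * ex n F / n ^ k) atTop (𝓝 F.turanDensity) := by
  have h := (tendsto_turanDensity F).mul (tendsto_descFactorial_div_pow k)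
  rw [mul_one] at h
  refine h.congr' ?_
  filter_upwards [eventually_ge_atTop k] with n hn
  have hpos : (n.choose k : ℝ) ≠ 0 := by exact_mod_cast (Nat.choose_pos hn).ne'
  rw [Nat.descFactorial_eq_factorial_mul_choose]
  push_cast
  field_simp

end KGraph

/-! ### Complete `k`-graphs, with and without an edge deleted -/

namespace KGraph

variable {k r : ℕ} {V W : Type*}

theorem mem_complete {l : ℕ} {e : Finset (Fin l)} : e ∈ (complete k l).edges ↔ e.card = k := by
  simp [complete, Finset.mem_powersetCard]

theorem free_complete_iff [DecidableEq W] {l : ℕ} {H : KGraph k W} :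
    H.Free (complete k l) ↔ ∀ S : Finset W, S.card = l → ∃ T ⊆ S, T.card = k ∧ T ∉ H.edges := by
  constructor
  · intro h S hS
    by_contra! hT
    have e : Fin l ≃ S := (S.equivFinOfCardEq hS).symm
    refine h ⟨e.toEmbedding.trans (Function.Embedding.subtype _), fun T hTc => hT _ ?_ ?_⟩
    · intro u hu
      obtain ⟨i, -, rfl⟩ := Finset.mem_map.mp hu
      exact (e i).2
    · rw [Finset.card_map, mem_complete.mp hTc]
  · rintro h ⟨f, hf⟩
    obtain ⟨T, hTS, hTc, hT⟩ := h (Finset.univ.map f) (by simp)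
    obtain ⟨T', -, rfl⟩ := Finset.subset_map_iff.mp hTS
    exact hT (hf _ (mem_complete.mpr (by simpa using hTc)))

theorem free_deleteEdge [DecidableEq W] {l : ℕ} {G : KGraph k W} {e : Finset (Fin l)}
    (he : e.card = k)
    (h : ∀ U D : Finset W, U.card = l → D ⊆ U → D.card = k →
      ∃ T ⊆ U, T.card = k ∧ T ≠ D ∧ T ∉ G.edges) :
    G.Free ((complete k l).deleteEdge e) := by
  rintro ⟨f, hf⟩
  obtain ⟨T, hTS, hTc, hTe, hT⟩ := h (Finset.univ.map f) (e.map f) (by simp)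
    (Finset.map_subset_map.mpr (Finset.subset_univ _)) (by simpa using he)
  obtain ⟨T', -, rfl⟩ := Finset.subset_map_iff.mp hTS
  refine hT (hf _ (Finset.mem_erase.mpr ⟨?_, mem_complete.mpr (by simpa using hTc)⟩))
  rintro rfl
  exact hTe rfl

theorem exists_edge_deleteEdge (hk : 3 ≤ k) {e : Finset (Fin (k + 2))} (he : e.card = k)
    (a b : Fin (k + 2)) (hab : a ≠ b) :
    ∃ T ∈ ((complete k (k + 2)).deleteEdge e).edges, a ∈ T ∧ b ∈ T := by
  obtain ⟨c, hce, hc⟩ : ∃ c ∈ e, c ∉ ({a, b} : Finset (Fin (k + 2))) := by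
    refine Finset.exists_mem_notMem_of_card_lt_card ?_
    rw [he, Finset.card_pair hab]
    omega
  obtain ⟨T, hT1, hT2, hT⟩ := Finset.exists_subsuperset_card_eq (n := k)
    (s := {a, b}) (t := Finset.univ.erase c)
    (fun x hx => Finset.mem_erase.mpr ⟨fun h => hc (h ▸ hx), Finset.mem_univ x⟩)
    (by rw [Finset.card_pair hab]; omega)
    (by rw [Finset.card_erase_of_mem (Finset.mem_univ c)]; simp)
  refine ⟨T, Finset.mem_erase.mpr ⟨?_, mem_complete.mpr hT⟩, hT1 (by simp), hT1 (by simp)⟩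
  rintro rfl
  exact Finset.notMem_erase c _ (hT2 hce)

/-! ### Adding a vertex with a prescribed link -/

/-- The `(r + 1)`-graph obtained from `H` by adding the vertex `none` with link `L`. -/
def addVertex [DecidableEq W] (H : KGraph (r + 1) W) (L : KGraph r W) :
    KGraph (r + 1) (Option W) where
  edges := H.edges.map (Finset.mapEmbedding Function.Embedding.some).toEmbedding ∪
    L.edges.map Finset.insertNone.toEmbedding
  card_eq := by
    intro e he
    rcases Finset.mem_union.mp he with h | h
    · obtain ⟨T, hT, rfl⟩ := Finset.mem_map.mp h
      simpa using H.card_eq T hT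
    · obtain ⟨A, hA, rfl⟩ := Finset.mem_map.mp h
      simpa using L.card_eq A hA

theorem map_some_mem_addVertex [DecidableEq W] {H : KGraph (r + 1) W} {L : KGraph r W}
    {T : Finset W} : T.map Function.Embedding.some ∈ (H.addVertex L).edges ↔ T ∈ H.edges := by
  simp only [addVertex, Finset.mem_union, Finset.mem_map, RelEmbedding.coe_toEmbedding,
    Finset.mapEmbedding_apply]
  constructor
  · rintro (⟨T', hT', h⟩ | ⟨A, hA, h⟩)
    · exact Finset.map_injective _ h ▸ hT'
    · have : none ∈ T.map Function.Embedding.some := h ▸ Finset.none_mem_insertNone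
      simp at this
  · exact fun h => Or.inl ⟨T, h, rfl⟩

theorem insertNone_mem_addVertex [DecidableEq W] {H : KGraph (r + 1) W} {L : KGraph r W}
    {A : Finset W} : Finset.insertNone A ∈ (H.addVertex L).edges ↔ A ∈ L.edges := by
  simp only [addVertex, Finset.mem_union, Finset.mem_map, RelEmbedding.coe_toEmbedding,
    Finset.mapEmbedding_apply]
  constructor
  · rintro (⟨T', hT', h⟩ | ⟨A', hA, h⟩)
    · have : none ∈ T'.map Function.Embedding.some := h ▸ Finset.none_mem_insertNone
      simp at this
    · exact Finset.insertNone.injective h ▸ hA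
  · exact fun h => Or.inr ⟨A, h, rfl⟩

theorem finset_option_cases [DecidableEq W] (U : Finset (Option W)) :
    (∃ S : Finset W, U = S.map Function.Embedding.some) ∨ ∃ S : Finset W, U = S.insertNone := by
  by_cases h : none ∈ U
  · exact Or.inr ⟨U.eraseNone, by rw [Finset.insertNone_eraseNone, Finset.insert_eq_of_mem h]⟩
  · exact Or.inl ⟨U.eraseNone, by rw [Finset.map_some_eraseNone, Finset.erase_eq_of_notMem h]⟩

/-- A `K_{k+1}`-free `k`-graph `H`, with a new vertex of link `L`, contains no `K_{k+2}` minus an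
edge if `L` is not complete on any `k + 1` vertices on which `H` misses at most one edge. -/
theorem addVertex_free [DecidableEq W] {H : KGraph (r + 1) W} {L : KGraph r W}
    (hH : H.Free (complete (r + 1) (r + 2)))
    (hL : ∀ S D : Finset W, S.card = r + 2 → (∀ A ⊆ S, A.card = r → A ∈ L.edges) →
      ∃ T ⊆ S, T.card = r + 1 ∧ T ≠ D ∧ T ∉ H.edges)
    {e : Finset (Fin (r + 3))} (he : e.card = r + 1) :
    (H.addVertex L).Free ((complete (r + 1) (r + 3)).deleteEdge e) := by
  rw [free_complete_iff] at hH
  refine free_deleteEdge he fun U D hU hDU hD => ?_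
  rcases finset_option_cases U with ⟨S, rfl⟩ | ⟨S, rfl⟩
  · -- Dropping a vertex of the missing edge `D` leaves `K_{k+1}` in `H`.
    obtain ⟨x, hx⟩ : D.Nonempty := Finset.card_pos.mp (by omega)
    obtain ⟨a, ha, rfl⟩ := Finset.mem_map.mp (hDU hx)
    rw [Finset.card_map] at hU
    obtain ⟨T, hTS, hT, hTH⟩ := hH (S.erase a) (by rw [Finset.card_erase_of_mem ha]; omega)
    refine ⟨T.map Function.Embedding.some, Finset.map_subset_map.mpr
      (hTS.trans (Finset.erase_subset _ _)), by simpa using hT, ?_,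
      fun h => hTH (map_some_mem_addVertex.mp h)⟩
    rintro rfl
    rw [Finset.mem_map'] at hx
    exact Finset.notMem_erase a S (hTS hx)
  · have hS : S.card = r + 2 := by simpa using hU
    have hsub : ∀ T ⊆ S, T.map Function.Embedding.some ⊆ Finset.insertNone S := by
      intro T hT x hx
      obtain ⟨a, ha, rfl⟩ := Finset.mem_map.mp hx
      exact Finset.some_mem_insertNone.mpr (hT ha)
    rcases finset_option_cases D with ⟨D, rfl⟩ | ⟨D, rfl⟩
    · by_cases hLS : ∀ A ⊆ S, A.card = r → A ∈ L.edges
      · obtain ⟨T, hTS, hT, hTD, hTH⟩ := hL S D hS hLS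
        exact ⟨T.map Function.Embedding.some, hsub T hTS, by simpa using hT,
          fun h => hTD (Finset.map_injective _ h), fun h => hTH (map_some_mem_addVertex.mp h)⟩
      · push Not at hLS
        obtain ⟨A, hAS, hA, hAL⟩ := hLS
        refine ⟨Finset.insertNone A, Finset.insertNone.monotone hAS, by simpa using hA, ?_,
          fun h => hAL (insertNone_mem_addVertex.mp h)⟩
        intro h
        have : none ∈ D.map Function.Embedding.some := h ▸ Finset.none_mem_insertNone
        simp at this
    · obtain ⟨T, hTS, hT, hTH⟩ := hH S hS
      refine ⟨T.map Function.Embedding.some, hsub T hTS, by simpa using hT, ?_,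
        fun h => hTH (map_some_mem_addVertex.mp h)⟩
      intro h
      have : none ∈ T.map Function.Embedding.some := h ▸ Finset.none_mem_insertNone
      simp at this

theorem tupleDensity_addVertex [Fintype W] [DecidableEq W] (H : KGraph (r + 1) W)
    (L : KGraph r W) (w : W → ℝ) (ε : ℝ) :
    tupleDensity (r + 1) (H.addVertex L).edges (fun x => x.elim ε fun u => (1 - ε) * w u) =
      (1 - ε) ^ (r + 1) * tupleDensity (r + 1) H.edges w +
        (r + 1) * ε * (1 - ε) ^ r * tupleDensity r L.edges w := by
  have hdisj : Disjoint (H.edges.map (Finset.mapEmbedding Function.Embedding.some).toEmbedding)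
      (L.edges.map Finset.insertNone.toEmbedding) := by
    rw [Finset.disjoint_left]
    rintro _ h1 h2
    obtain ⟨T, -, rfl⟩ := Finset.mem_map.mp h1
    obtain ⟨A, -, h⟩ := Finset.mem_map.mp h2
    have : none ∈ T.map Function.Embedding.some := by
      have h' : Finset.insertNone A = T.map Function.Embedding.some := h
      exact h' ▸ Finset.none_mem_insertNone
    simp at this
  rw [tupleDensity_eq (H.addVertex L).card_eq, tupleDensity_eq H.card_eq,
    tupleDensity_eq L.card_eq]
  have h1 : ∀ T ∈ H.edges, ∏ u ∈ T, ((1 - ε) * w u) = (1 - ε) ^ (r + 1) * ∏ u ∈ T, w u :=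
    fun T hT => by rw [Finset.prod_mul_distrib, Finset.prod_const, H.card_eq T hT]
  have h2 : ∀ A ∈ L.edges, ε * ∏ u ∈ A, ((1 - ε) * w u) = ε * (1 - ε) ^ r * ∏ u ∈ A, w u :=
    fun A hA => by rw [Finset.prod_mul_distrib, Finset.prod_const, L.card_eq A hA, mul_assoc]
  simp only [addVertex]
  rw [Finset.sum_union hdisj, Finset.sum_map, Finset.sum_map]
  simp only [RelEmbedding.coe_toEmbedding, Finset.mapEmbedding_apply, Finset.prod_map,
    Finset.prod_insertNone, Function.Embedding.some_apply, Option.elim_some, Option.elim_none]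
  rw [Finset.sum_congr rfl h1, Finset.sum_congr rfl h2, ← Finset.mul_sum,
    ← Finset.mul_sum, Nat.factorial_succ]
  push_cast
  ring

/-- Adding a vertex of weight `ε` with link `L` bounds the Turán density from below. -/
theorem mix_le_turanDensity [Fintype W] [DecidableEq W] {H : KGraph (r + 1) W} {L : KGraph r W}
    (hr : 2 ≤ r) (hH : H.Free (complete (r + 1) (r + 2)))
    (hL : ∀ S D : Finset W, S.card = r + 2 → (∀ A ⊆ S, A.card = r → A ∈ L.edges) →
      ∃ T ⊆ S, T.card = r + 1 ∧ T ≠ D ∧ T ∉ H.edges)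
    {e : Finset (Fin (r + 3))} (he : e.card = r + 1) {w : W → ℝ} (hw : ∀ u, 0 ≤ w u)
    (hw1 : ∑ u, w u = 1) {ε : ℝ} (hε0 : 0 ≤ ε) (hε1 : ε ≤ 1) :
    (1 - ε) ^ (r + 1) * tupleDensity (r + 1) H.edges w +
        (r + 1) * ε * (1 - ε) ^ r * tupleDensity r L.edges w ≤
      ((complete (r + 1) (r + 3)).deleteEdge e).turanDensity := by
  rw [← tupleDensity_addVertex]
  refine tupleDensity_le_turanDensity (exists_edge_deleteEdge (by omega) he)
    (addVertex_free hH hL he) ?_ ?_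
  · rintro (_ | u)
    · exact hε0
    · exact mul_nonneg (by linarith) (hw u)
  · rw [Fintype.sum_option]
    simp [← Finset.mul_sum, hw1]

end KGraph

/-- If mixtures `(1 - ε) ^ (r + 1) A + (r + 1) ε (1 - ε) ^ r B` with `A` close to `p` and `B` close
to `p + δ` never exceed `q`, then `p < q`: for small `ε`, the mixture is at least
`p + (r + 1) δ ε - O(ε²)`. -/
theorem lt_of_mix_le {r : ℕ} {p q δ : ℝ} (hr : 1 ≤ r) (hp : 0 ≤ p) (hδ : 0 < δ)
    (h : ∀ η > 0, ∃ A B : ℝ, p - η ≤ A ∧ p + δ - η ≤ B ∧ ∀ ε, 0 ≤ ε → ε ≤ 1 →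
      (1 - ε) ^ (r + 1) * A + (r + 1) * ε * (1 - ε) ^ r * B ≤ q) : p < q := by
  have hr' : (1 : ℝ) ≤ r := by exact_mod_cast hr
  have key : ∀ ε, 0 ≤ ε → ε ≤ 1 →
      (1 - ε) ^ (r + 1) * p + (r + 1) * ε * (1 - ε) ^ r * (p + δ) ≤ q := by
    intro ε h0 h1
    refine le_of_forall_pos_le_add fun η hη => ?_
    obtain ⟨A, B, hA, hB, hAB⟩ := h (η / (r + 2)) (by positivity)
    have hq := hAB ε h0 h1
    have e0 : 0 ≤ 1 - ε := by linarith
    have a1 : (1 - ε) ^ (r + 1) ≤ 1 := pow_le_one₀ e0 (by linarith)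
    have a2 : (1 - ε) ^ r ≤ 1 := pow_le_one₀ e0 (by linarith)
    have b1 : (0 : ℝ) ≤ (1 - ε) ^ (r + 1) := by positivity
    have b2 : (0 : ℝ) ≤ (r + 1) * ε * (1 - ε) ^ r := by positivity
    have c2 : (r + 1) * ε * (1 - ε) ^ r ≤ (r + 1) * 1 * 1 := by gcongr
    have d1 := mul_le_mul_of_nonneg_left hA b1
    have d2 := mul_le_mul_of_nonneg_left hB b2
    have hz : 0 ≤ η / (r + 2) := by positivity
    have d3 : ((1 - ε) ^ (r + 1) + (r + 1) * ε * (1 - ε) ^ r) * (η / (r + 2)) ≤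
        (r + 2) * (η / (r + 2)) := mul_le_mul_of_nonneg_right (by linarith) hz
    have d4 : ((r : ℝ) + 2) * (η / (r + 2)) = η := by field_simp
    nlinarith
  set M : ℝ := r * p + (r + 1) * δ with hM
  have hM0 : 0 ≤ M := by positivity
  have hden : 0 < r * M + δ + 1 := by positivity
  set ε : ℝ := δ / (r * M + δ + 1) with hε
  have hε0 : 0 < ε := by positivity
  have hε1 : ε ≤ 1 := by
    rw [hε, div_le_one hden]
    nlinarith [mul_nonneg (by linarith : (0 : ℝ) ≤ r) hM0]
  have hεM : ε * (r * M) ≤ δ := by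
    rw [hε, div_mul_eq_mul_div, div_le_iff₀ hden]
    nlinarith [mul_nonneg (by linarith : (0 : ℝ) ≤ r) hM0]
  have hb : 1 - r * ε ≤ (1 - ε) ^ r := by
    have := one_add_mul_le_pow (a := -ε) (by linarith) r
    rw [← sub_eq_add_neg] at this
    linarith
  refine lt_of_lt_of_le ?_ (key ε hε0.le hε1)
  calc p < p + ε * ((r + 1) * δ - ε * (r * M)) := by
        have : 0 < (r + 1) * δ - ε * (r * M) := by nlinarith
        linarith [mul_pos hε0 this]
    _ = (1 - r * ε) * (p + ε * M) := by rw [hM]; ring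
    _ ≤ (1 - ε) ^ r * (p + ε * M) := mul_le_mul_of_nonneg_right hb (by positivity)
    _ = _ := by rw [hM, pow_succ]; ring

/-! ### Links and clones -/

/-- The mean over tuples of pairs with a product weight is an iterated mean. -/
theorem tupleMean_prod {ι V C : Type*} [Fintype ι] [DecidableEq ι] [Fintype V] [Fintype C]
    (w : V → ℝ) (q : C → ℝ) (g : (ι → V × C) → ℝ) :
    tupleMean (fun x : V × C => w x.1 * q x.2) g =
      tupleMean w fun u => tupleMean q fun c => g fun i => (u i, c i) := by
  simp only [tupleMean]
  rw [← (Equiv.arrowProdEquivProdArrow ι (fun _ => V) (fun _ => C)).symm.sum_comp,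
    Fintype.sum_prod_type]
  refine Finset.sum_congr rfl fun u _ => ?_
  rw [Finset.mul_sum]
  refine Finset.sum_congr rfl fun c _ => ?_
  simp only [Equiv.arrowProdEquivProdArrow, Equiv.coe_fn_symm_mk, Finset.prod_mul_distrib]
  ring

namespace KGraph

variable {k r : ℕ} {V W C : Type*}

/-- The link of the vertex `v`: the `r`-sets which form an edge together with `v`. -/
def link [Fintype V] [DecidableEq V] (H : KGraph (r + 1) V) (v : V) : KGraph r V where
  edges := Finset.univ.filter fun A => A.card = r ∧ v ∉ A ∧ insert v A ∈ H.edges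
  card_eq := fun _ he => (Finset.mem_filter.mp he).2.1

theorem mem_link [Fintype V] [DecidableEq V] {H : KGraph (r + 1) V} {v : V} {A : Finset V} :
    A ∈ (H.link v).edges ↔ A.card = r ∧ v ∉ A ∧ insert v A ∈ H.edges := by
  simp [link]

/-- Some link is at least as dense as the whole graph, since the mean of the link densities is the
density of the graph. -/
theorem exists_tupleDensity_le_link [Fintype V] [DecidableEq V] (H : KGraph (r + 1) V)
    {w : V → ℝ} (hw : ∀ u, 0 ≤ w u) (hw1 : ∑ u, w u = 1) :
    ∃ v, tupleDensity (r + 1) H.edges w ≤ tupleDensity r (H.link v).edges w := by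
  have : Nonempty V := by
    by_contra hne
    rw [not_nonempty_iff] at hne
    simp at hw1
  obtain ⟨v, hv⟩ := Finite.exists_max fun v => tupleDensity r (H.link v).edges w
  refine ⟨v, ?_⟩
  have h1 : tupleDensity (r + 1) H.edges w ≤ ∑ u, w u * tupleDensity r (H.link u).edges w := by
    simp only [tupleDensity, tupleMean]
    rw [← (Fin.consEquiv fun _ : Fin (r + 1) => V).sum_comp, Fintype.sum_prod_type]
    refine Finset.sum_le_sum fun u _ => ?_
    rw [Finset.mul_sum]
    refine Finset.sum_le_sum fun f _ => ?_
    simp only [Fin.consEquiv, Equiv.coe_fn_mk, Fin.prod_univ_succ, Fin.cons_zero, Fin.cons_succ]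
    rw [mul_assoc]
    refine mul_le_mul_of_nonneg_left (mul_le_mul_of_nonneg_left ?_
      (Finset.prod_nonneg fun _ _ => hw _)) (hw u)
    have himage : Finset.univ.image (Fin.cons u f : Fin (r + 1) → V) =
        insert u (Finset.univ.image f) := by
      ext x
      simp [Fin.exists_fin_succ, eq_comm]
    have hmem : Finset.univ.image (Fin.cons u f : Fin (r + 1) → V) ∈ H.edges →
        Finset.univ.image f ∈ (H.link u).edges := by
      intro h
      have hc := H.card_eq _ h
      have hle : (Finset.univ.image f).card ≤ r := by
        simpa using Finset.card_image_le (s := (Finset.univ : Finset (Fin r))) (f := f)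
      rw [himage] at h hc
      have hu : u ∉ Finset.univ.image f := by
        intro hu
        rw [Finset.insert_eq_of_mem hu] at hc
        omega
      rw [Finset.card_insert_of_notMem hu] at hc
      exact mem_link.mpr ⟨by omega, hu, h⟩
    change (if Finset.univ.image (Fin.cons u f : Fin (r + 1) → V) ∈ H.edges then (1 : ℝ) else 0) ≤ _
    split_ifs with h h' h'
    · exact le_rfl
    · exact absurd (hmem h) h'
    · exact zero_le_one
    · exact le_rfl
  calc _ ≤ _ := h1
    _ ≤ ∑ u, w u * tupleDensity r (H.link v).edges w :=
        Finset.sum_le_sum fun u _ => mul_le_mul_of_nonneg_left (hv u) (hw u)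
    _ = _ := by rw [← Finset.sum_mul, hw1, one_mul]

theorem tupleDensity_comap_fst [Fintype V] [DecidableEq V] [Fintype C] [DecidableEq C]
    (H : KGraph k V) (w : V → ℝ) {q : C → ℝ} (hq1 : ∑ c, q c = 1) :
    tupleDensity k (H.comap (Prod.fst : V × C → V)).edges (fun x => w x.1 * q x.2) =
      tupleDensity k H.edges w := by
  rw [tupleDensity, tupleMean_prod, tupleDensity]
  congr 1
  ext u
  rw [← tupleMean_const (ι := Fin k) hq1 (if Finset.univ.image u ∈ H.edges then 1 else 0)]
  congr 1
  ext c
  have himage : (Finset.univ.image fun i => (u i, c i)).image Prod.fst = Finset.univ.image u := by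
    rw [Finset.image_image]; rfl
  refine if_congr ?_ rfl rfl
  rw [mem_comap, himage]
  refine ⟨And.right, fun h => ⟨le_antisymm ?_ ?_, h⟩⟩
  · simpa using Finset.card_image_le (s := (Finset.univ : Finset (Fin k)))
      (f := fun i => (u i, c i))
  · calc k = (Finset.univ.image u).card := (H.card_eq _ h).symm
      _ ≤ _ := himage ▸ Finset.card_image_le

theorem exists_edge_complete (hr : 1 ≤ r) (a b : Fin (r + 2)) (hab : a ≠ b) :
    ∃ T ∈ (complete (r + 1) (r + 2)).edges, a ∈ T ∧ b ∈ T := by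
  obtain ⟨T, hT1, -, hT⟩ := Finset.exists_subsuperset_card_eq (n := r + 1)
    (Finset.subset_univ {a, b}) (by rw [Finset.card_pair hab]; omega) (by simp)
  exact ⟨T, mem_complete.mpr hT, hT1 (by simp), hT1 (by simp)⟩

/-- In a blow-up of a `K_{r+2}`-free `(r + 1)`-graph, no edge is a clique of the blown-up link of
a vertex. -/
theorem notMem_comap_of_link [Fintype V] [DecidableEq V] [Fintype W] [DecidableEq W]
    {H : KGraph (r + 1) V} (hr : 1 ≤ r) (hH : H.Free (complete (r + 1) (r + 2))) {φ : W → V}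
    {v : V} {T : Finset W} (hT : ∀ A ⊆ T, A.card = r → A.image φ ∈ (H.link v).edges) :
    T ∉ (H.comap φ).edges := by
  intro hTH
  have hinj := injOn_of_mem_comap hTH
  obtain ⟨hTc, hTim⟩ := mem_comap.mp hTH
  have hv : v ∉ T.image φ := by
    intro hv
    obtain ⟨a, ha, rfl⟩ := Finset.mem_image.mp hv
    obtain ⟨A, hA1, hA2, hA⟩ := Finset.exists_subsuperset_card_eq (n := r)
      (Finset.singleton_subset_iff.mpr ha) (by simpa using hr) (by omega)
    exact (mem_link.mp (hT A hA2 hA)).2.1 (Finset.mem_image_of_mem _ (hA1 (by simp)))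
  obtain ⟨X, hXS, hX, hXH⟩ := free_complete_iff.mp hH (insert v (T.image φ))
    (by rw [Finset.card_insert_of_notMem hv, H.card_eq _ hTim])
  by_cases hvX : v ∈ X
  · have hsub : X.erase v ⊆ T.image φ := by
      intro x hx
      rw [Finset.mem_erase] at hx
      exact Finset.mem_of_mem_insert_of_ne (hXS hx.2) hx.1
    obtain ⟨A, hAT, hA⟩ := Finset.subset_image_iff.mp hsub
    have hAc : A.card = r := by
      rw [← Finset.card_image_iff.mpr (hinj.mono hAT), hA, Finset.card_erase_of_mem hvX, hX]
      rfl
    have h := (mem_link.mp (hT A (by exact_mod_cast hAT) hAc)).2.2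
    rw [hA, Finset.insert_erase hvX] at h
    exact hXH h
  · have hsub : X ⊆ T.image φ := fun x hx =>
      Finset.mem_of_mem_insert_of_ne (hXS hx) fun h => hvX (h ▸ hx)
    rw [Finset.eq_of_subset_of_card_le hsub (by rw [hX, H.card_eq _ hTim])] at hXH
    exact hXH hTim

/-! ### Modified links, for `r ≥ 3` -/

open Classical in
/-- An `r`-graph on three clones of each vertex. It agrees with the link of `v`, except that it has
no set with two clones of colour `0`, none with a clone of colour `0` and two of colour `1`, and
every other set with clones of both these colours. -/
noncomputable def modifiedLink [Fintype V] [DecidableEq V] (H : KGraph (r + 1) V) (v : V) :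
    KGraph r (V × Fin 3) where
  edges := Finset.univ.filter fun A => A.card = r ∧
    (∀ a ∈ A, ∀ b ∈ A, a.2 = 0 → b.2 = 0 → a = b) ∧
    (∀ a ∈ A, ∀ b ∈ A, ∀ c ∈ A, a.2 = 0 → b.2 = 1 → c.2 = 1 → b = c) ∧
    (((∃ a ∈ A, a.2 = 0) ∧ ∃ b ∈ A, b.2 = 1) ∨ A.image Prod.fst ∈ (H.link v).edges)
  card_eq := fun _ he => (Finset.mem_filter.mp he).2.1

theorem mem_modifiedLink [Fintype V] [DecidableEq V] {H : KGraph (r + 1) V} {v : V}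
    {A : Finset (V × Fin 3)} : A ∈ (H.modifiedLink v).edges ↔ A.card = r ∧
    (∀ a ∈ A, ∀ b ∈ A, a.2 = 0 → b.2 = 0 → a = b) ∧
    (∀ a ∈ A, ∀ b ∈ A, ∀ c ∈ A, a.2 = 0 → b.2 = 1 → c.2 = 1 → b = c) ∧
    (((∃ a ∈ A, a.2 = 0) ∧ ∃ b ∈ A, b.2 = 1) ∨ A.image Prod.fst ∈ (H.link v).edges) := by
  simp only [modifiedLink, Finset.mem_filter, Finset.mem_univ, true_and]

/-- If the modified link is complete on `r + 2` vertices, then two of their `(r + 1)`-subsets are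
cliques of the blown-up link: omit the vertex of colour `0`, or the vertex of colour `1`. -/
theorem modifiedLink_valid [Fintype V] [DecidableEq V] {H : KGraph (r + 1) V} (hr : 3 ≤ r)
    (hH : H.Free (complete (r + 1) (r + 2))) (v : V) (S D : Finset (V × Fin 3))
    (hS : S.card = r + 2) (hA : ∀ A ⊆ S, A.card = r → A ∈ (H.modifiedLink v).edges) :
    ∃ T ⊆ S, T.card = r + 1 ∧ T ≠ D ∧ T ∉ (H.comap (Prod.fst : V × Fin 3 → V)).edges := by
  -- It suffices to find two vertices whose omission leaves a set missing one of the two colours.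
  suffices h : ∃ p ∈ S, ∃ q ∈ S, p ≠ q ∧
      ((∀ a ∈ S.erase p, a.2 ≠ 0) ∨ ∀ a ∈ S.erase p, a.2 ≠ 1) ∧
      ((∀ a ∈ S.erase q, a.2 ≠ 0) ∨ ∀ a ∈ S.erase q, a.2 ≠ 1) by
    obtain ⟨p, hp, q, hq, hpq, hp', hq'⟩ := h
    have key : ∀ p ∈ S, ((∀ a ∈ S.erase p, a.2 ≠ 0) ∨ ∀ a ∈ S.erase p, a.2 ≠ 1) →
        S.erase p ∉ (H.comap (Prod.fst : V × Fin 3 → V)).edges := by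
      intro p hp hp'
      refine notMem_comap_of_link (v := v) (by omega) hH fun A hAS hAc => ?_
      refine (mem_modifiedLink.mp (hA A (hAS.trans (Finset.erase_subset _ _)) hAc)).2.2.2.resolve_left
        ?_
      rintro ⟨⟨a, ha, ha0⟩, b, hb, hb1⟩
      rcases hp' with h | h
      · exact h a (hAS ha) ha0
      · exact h b (hAS hb) hb1
    by_cases hD : S.erase p = D
    · refine ⟨S.erase q, Finset.erase_subset _ _, by rw [Finset.card_erase_of_mem hq]; omega, ?_,
        key q hq hq'⟩
      rintro rfl
      exact hpq (Finset.erase_injOn S hp hq hD)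
    · exact ⟨S.erase p, Finset.erase_subset _ _, by rw [Finset.card_erase_of_mem hp]; omega, hD,
        key p hp hp'⟩
  have hext : ∀ X ⊆ S, X.card ≤ r → ∃ A ⊆ S, X ⊆ A ∧ A ∈ (H.modifiedLink v).edges := by
    intro X hX hXc
    obtain ⟨A, h1, h2, h3⟩ := Finset.exists_subsuperset_card_eq hX hXc (by omega)
    exact ⟨A, h2, h1, hA A h2 h3⟩
  have h0 : ∀ a ∈ S, ∀ b ∈ S, a.2 = 0 → b.2 = 0 → a = b := by
    intro a ha b hb
    obtain ⟨A, -, hXA, hAL⟩ := hext {a, b} (by simp [Finset.insert_subset_iff, ha, hb])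
      (Finset.card_le_two.trans (by omega))
    exact (mem_modifiedLink.mp hAL).2.1 a (hXA (by simp)) b (hXA (by simp))
  have h1 : ∀ a ∈ S, ∀ b ∈ S, ∀ c ∈ S, a.2 = 0 → b.2 = 1 → c.2 = 1 → b = c := by
    intro a ha b hb c hc
    obtain ⟨A, -, hXA, hAL⟩ := hext {a, b, c} (by simp [Finset.insert_subset_iff, ha, hb, hc])
      (Finset.card_le_three.trans (by omega))
    exact (mem_modifiedLink.mp hAL).2.2.1 a (hXA (by simp)) b (hXA (by simp)) c (hXA (by simp))
  by_cases hz : ∃ p ∈ S, p.2 = 0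
  · obtain ⟨p, hp, hp0⟩ := hz
    have hpz : ∀ a ∈ S.erase p, a.2 ≠ 0 := fun a ha h =>
      Finset.ne_of_mem_erase ha (h0 a (Finset.mem_of_mem_erase ha) p hp h hp0)
    obtain ⟨q, hq, hqp, hq1⟩ : ∃ q ∈ S, q ≠ p ∧ ∀ a ∈ S.erase q, a.2 ≠ 1 := by
      by_cases ho : ∃ q ∈ S, q.2 = 1
      · obtain ⟨q, hq, hq1⟩ := ho
        refine ⟨q, hq, by rintro rfl; simp [hp0] at hq1, fun a ha h => ?_⟩
        exact Finset.ne_of_mem_erase ha (h1 p hp a (Finset.mem_of_mem_erase ha) q hq hp0 h hq1)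
      · push Not at ho
        obtain ⟨q, hq, hqp⟩ := Finset.exists_mem_ne (s := S) (by omega) p
        exact ⟨q, hq, hqp, fun a ha => ho a (Finset.mem_of_mem_erase ha)⟩
    exact ⟨p, hp, q, hq, hqp.symm, Or.inl hpz, Or.inr hq1⟩
  · push Not at hz
    obtain ⟨p, hp, q, hq, hpq⟩ := Finset.one_lt_card.mp (by omega : 1 < S.card)
    exact ⟨p, hp, q, hq, hpq, Or.inl fun a ha => hz a (Finset.mem_of_mem_erase ha),
      Or.inl fun a ha => hz a (Finset.mem_of_mem_erase ha)⟩

end KGraph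

/-! ### Densities of modified links -/

namespace KGraph

variable {k r : ℕ} {V W : Type*}

/-- The tuple density of the modified link: the tuples in the link of `v` lose at most the
probability of a forbidden colouring, and the other injective tuples gain a full colouring. -/
theorem le_tupleDensity_modifiedLink [Fintype V] [DecidableEq V] (H : KGraph (r + 2 + 1) V)
    (v : V) {w : V → ℝ} (hw : ∀ u, 0 ≤ w u) {q : Fin 3 → ℝ} (hq : ∀ c, 0 ≤ q c)
    (hq1 : ∑ c, q c = 1) :
    (1 - ((r + 2) ^ 2 * q 0 ^ 2 + (r + 2) ^ 3 * (q 0 * q 1 ^ 2))) *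
        tupleDensity (r + 2) (H.link v).edges w +
      q 0 * q 1 * q 2 ^ r * ((tupleMean w fun u : Fin (r + 2) → V =>
        if Function.Injective u then 1 else 0) - tupleDensity (r + 2) (H.link v).edges w) ≤
      tupleDensity (r + 2) (H.modifiedLink v).edges (fun x => w x.1 * q x.2) := by
  set l : ℝ := (r + 2) ^ 2 * q 0 ^ 2 + (r + 2) ^ 3 * (q 0 * q 1 ^ 2) with hl
  rw [tupleDensity, tupleDensity, tupleMean_prod, ← tupleMean_const_mul, ← tupleMean_sub,
    ← tupleMean_const_mul, ← tupleMean_add]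
  refine tupleMean_mono hw fun u => ?_
  have himage : ∀ c : Fin (r + 2) → Fin 3,
      (Finset.univ.image fun i => (u i, c i)).image Prod.fst = Finset.univ.image u := by
    intro c
    rw [Finset.image_image]; rfl
  have hcard : Function.Injective u → ∀ c : Fin (r + 2) → Fin 3,
      (Finset.univ.image fun i => (u i, c i)).card = r + 2 := by
    intro hu c
    rw [Finset.card_image_of_injective _ fun i j h => hu (congrArg Prod.fst h)]
    simp
  have hnonneg : 0 ≤ tupleMean q fun c : Fin (r + 2) → Fin 3 =>
      if (Finset.univ.image fun i => (u i, c i)) ∈ (H.modifiedLink v).edges then (1 : ℝ) else 0 :=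
    tupleMean_nonneg hq fun c => by split_ifs <;> simp
  by_cases hu : Function.Injective u
  swap
  · have hu' : Finset.univ.image u ∉ (H.link v).edges := by
      intro h
      have hc : (Finset.univ.image u).card = (Finset.univ : Finset (Fin (r + 2))).card := by
        rw [(H.link v).card_eq _ h, Finset.card_univ, Fintype.card_fin]
      have hinj := Finset.card_image_iff.mp hc
      rw [Finset.coe_univ] at hinj
      exact hu (Set.injOn_univ.mp hinj)
    rw [if_neg hu, if_neg hu']
    simpa using hnonneg
  by_cases huL : Finset.univ.image u ∈ (H.link v).edges
  · rw [if_pos hu, if_pos huL]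
    -- A union bound over the pairs and triples of positions with forbidden colours.
    let P : Finset (Fin (r + 2) × Fin (r + 2)) := Finset.univ.filter fun p => p.1 ≠ p.2
    let Q : Finset (Fin (r + 2) × Fin (r + 2) × Fin (r + 2)) :=
      Finset.univ.filter fun p => p.1 ≠ p.2.1 ∧ p.1 ≠ p.2.2 ∧ p.2.1 ≠ p.2.2
    let s : Fin (r + 2) → Fin (r + 2) → Fin 3 := fun i x => if x = i then 0 else 1
    have hpt : ∀ c : Fin (r + 2) → Fin 3,
        1 - ((∑ p ∈ P, if ∀ i ∈ ({p.1, p.2} : Finset (Fin (r + 2))), c i = 0 then (1 : ℝ) else 0) +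
          ∑ p ∈ Q, if ∀ i ∈ ({p.1, p.2.1, p.2.2} : Finset (Fin (r + 2))), c i = s p.1 i
            then (1 : ℝ) else 0) ≤
        if (Finset.univ.image fun i => (u i, c i)) ∈ (H.modifiedLink v).edges then 1 else 0 := by
      intro c
      have n1 : ∀ p ∈ P, (0 : ℝ) ≤
          if ∀ i ∈ ({p.1, p.2} : Finset (Fin (r + 2))), c i = 0 then (1 : ℝ) else 0 :=
        fun p _ => by split_ifs <;> simp
      have n2 : ∀ p ∈ Q, (0 : ℝ) ≤ if ∀ i ∈ ({p.1, p.2.1, p.2.2} : Finset (Fin (r + 2))),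
          c i = s p.1 i then (1 : ℝ) else 0 :=
        fun p _ => by split_ifs <;> simp
      have N1 := Finset.sum_nonneg n1
      have N2 := Finset.sum_nonneg n2
      split_ifs with h
      · linarith
      by_cases h0 : ∃ i j, i ≠ j ∧ c i = 0 ∧ c j = 0
      · obtain ⟨i, j, hij, hi, hj⟩ := h0
        have := Finset.single_le_sum n1 (Finset.mem_filter.mpr ⟨Finset.mem_univ (i, j), hij⟩)
        rw [if_pos (by simp [hi, hj])] at this
        linarith
      by_cases h1 : ∃ i j m, j ≠ m ∧ c i = 0 ∧ c j = 1 ∧ c m = 1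
      · obtain ⟨i, j, m, hjm, hi, hj, hm⟩ := h1
        have hij : i ≠ j := by rintro rfl; simp [hi] at hj
        have him : i ≠ m := by rintro rfl; simp [hi] at hm
        have := Finset.single_le_sum n2
          (Finset.mem_filter.mpr ⟨Finset.mem_univ (i, j, m), hij, him, hjm⟩)
        rw [if_pos (by simp [s, hi, hj, hm, hij.symm, him.symm])] at this
        linarith
      exfalso
      push Not at h0 h1
      refine h (mem_modifiedLink.mpr ⟨hcard hu c, ?_, ?_, Or.inr (by rwa [himage])⟩)
      · intro a ha b hb ha0 hb0
        obtain ⟨i, -, rfl⟩ := Finset.mem_image.mp ha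
        obtain ⟨j, -, rfl⟩ := Finset.mem_image.mp hb
        by_contra hne
        exact h0 i j (by rintro rfl; exact hne rfl) ha0 hb0
      · intro a ha b hb d hd ha0 hb1 hd1
        obtain ⟨i, -, rfl⟩ := Finset.mem_image.mp ha
        obtain ⟨j, -, rfl⟩ := Finset.mem_image.mp hb
        obtain ⟨m, -, rfl⟩ := Finset.mem_image.mp hd
        by_contra hne
        exact h1 i j m (by rintro rfl; exact hne rfl) ha0 hb1 hd1
    refine le_trans ?_ (tupleMean_mono hq hpt)
    rw [tupleMean_sub, tupleMean_add, tupleMean_sum, tupleMean_sum, tupleMean_const hq1]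
    have e1 : ∀ p ∈ P, tupleMean q (fun c : Fin (r + 2) → Fin 3 =>
        if ∀ i ∈ ({p.1, p.2} : Finset (Fin (r + 2))), c i = 0 then (1 : ℝ) else 0) = q 0 ^ 2 := by
      intro p hp
      rw [tupleMean_prescribed hq1 _ fun _ => 0, Finset.prod_const,
        Finset.card_pair (Finset.mem_filter.mp hp).2]
    have e2 : ∀ p ∈ Q, tupleMean q (fun c : Fin (r + 2) → Fin 3 =>
        if ∀ i ∈ ({p.1, p.2.1, p.2.2} : Finset (Fin (r + 2))), c i = s p.1 i
          then (1 : ℝ) else 0) = q 0 * q 1 ^ 2 := by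
      intro p hp
      obtain ⟨h1, h2, h3⟩ := (Finset.mem_filter.mp hp).2
      rw [tupleMean_prescribed hq1, Finset.prod_insert (by simp [h1, h2]), Finset.prod_pair h3]
      simp [s, h1.symm, h2.symm, sq]
    rw [Finset.sum_congr rfl e1, Finset.sum_congr rfl e2, Finset.sum_const, Finset.sum_const,
      nsmul_eq_mul, nsmul_eq_mul]
    have c1 : (P.card : ℝ) ≤ (r + 2) ^ 2 := by
      have : P.card ≤ (r + 2) ^ 2 := (Finset.card_le_univ P).trans_eq (by simp [sq])
      exact_mod_cast this
    have c2 : (Q.card : ℝ) ≤ (r + 2) ^ 3 := by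
      have : Q.card ≤ (r + 2) ^ 3 := (Finset.card_le_univ Q).trans_eq (by simp; ring)
      exact_mod_cast this
    have d1 := mul_le_mul_of_nonneg_right c1 (sq_nonneg (q 0))
    have d2 := mul_le_mul_of_nonneg_right c2 (mul_nonneg (hq 0) (sq_nonneg (q 1)))
    rw [hl]
    linarith
  · rw [if_pos hu, if_neg huL]
    -- A single colouring of the tuple suffices: `0`, `1`, and `2` at all other positions.
    let s : Fin (r + 2) → Fin 3 := Fin.cons 0 (Fin.cons 1 fun _ => 2)
    have hs := tupleMean_prescribed hq1 Finset.univ s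
    rw [Fin.prod_univ_succ, Fin.prod_univ_succ] at hs
    simp only [s, Fin.cons_zero, Fin.cons_succ, Finset.prod_const, Finset.card_univ,
      Fintype.card_fin] at hs
    have hval : (1 - l) * 0 + q 0 * q 1 * q 2 ^ r * (1 - 0) = q 0 * (q 1 * q 2 ^ r) := by ring
    rw [hval, ← hs]
    refine tupleMean_mono hq fun c => ?_
    split_ifs with hc hM hM
    · exact le_rfl
    · exfalso
      obtain rfl : c = s := funext fun i => hc i (Finset.mem_univ i)
      have s0 : ∀ i, s i = 0 → i = 0 := by
        intro i
        refine Fin.cases (fun _ => rfl) (fun i => ?_) i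
        refine Fin.cases (fun h => ?_) (fun i h => ?_) i <;> simp [s] at h
      have s1 : ∀ i, s i = 1 → i = Fin.succ 0 := by
        intro i
        refine Fin.cases (fun h => ?_) (fun i => ?_) i
        · simp [s] at h
        refine Fin.cases (fun _ => rfl) (fun i h => ?_) i
        simp [s] at h
      refine hM (mem_modifiedLink.mpr ⟨hcard hu s, ?_, ?_, Or.inl ⟨?_, ?_⟩⟩)
      · intro a ha b hb ha0 hb0
        obtain ⟨i, -, rfl⟩ := Finset.mem_image.mp ha
        obtain ⟨j, -, rfl⟩ := Finset.mem_image.mp hb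
        rw [s0 i ha0, s0 j hb0]
      · intro a ha b hb d hd ha0 hb1 hd1
        obtain ⟨j, -, rfl⟩ := Finset.mem_image.mp hb
        obtain ⟨m, -, rfl⟩ := Finset.mem_image.mp hd
        rw [s1 j hb1, s1 m hd1]
      · exact ⟨_, Finset.mem_image_of_mem _ (Finset.mem_univ 0), rfl⟩
      · exact ⟨_, Finset.mem_image_of_mem _ (Finset.mem_univ (Fin.succ 0)), rfl⟩
    · exact zero_le_one
    · exact le_rfl

/-- The probability that `r` uniformly random vertices are distinct. -/
theorem tupleMean_injective_uniform (n r : ℕ) :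
    tupleMean (fun _ : Fin n => (n : ℝ)⁻¹) (fun u : Fin r → Fin n =>
      if Function.Injective u then 1 else 0) = n.descFactorial r / n ^ r := by
  simp only [tupleMean, Finset.prod_const, Finset.card_univ, Fintype.card_fin]
  rw [← Finset.mul_sum, Finset.sum_boole, ← Fintype.card_subtype,
    Fintype.card_congr (Equiv.subtypeInjectiveEquivEmbedding _ _), Fintype.card_embedding_eq,
    Fintype.card_fin, Fintype.card_fin, inv_pow]
  ring

/-! ### From dense links to a strict inequality -/

theorem turanDensity_nonneg (F : KGraph k V) : 0 ≤ F.turanDensity :=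
  ge_of_tendsto' (tendsto_turanDensity F) fun _ => by positivity

theorem turanDensity_le_of_forall {F : KGraph k V} (hF : F.edges.Nonempty) {c : ℝ}
    (h : ∀ n : ℕ, 0 < n → ∀ H : KGraph k (Fin n), H.Free F →
      tupleDensity k H.edges (fun _ => (n : ℝ)⁻¹) ≤ c) : F.turanDensity ≤ c := by
  refine le_of_tendsto (tendsto_ex_div_pow F) ?_
  filter_upwards [eventually_gt_atTop 0] with n hn
  obtain ⟨H, hH, hHc⟩ := exists_card_eq_ex n hF
  rw [← hHc, ← tupleDensity_uniform]
  exact h n hn H hH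

theorem sum_uniform {n : ℕ} (hn : 0 < n) : ∑ _u : Fin n, (n : ℝ)⁻¹ = 1 := by
  have : (n : ℝ) ≠ 0 := by positivity
  simp [this]

theorem complete_edges_nonempty {l : ℕ} (h : k ≤ l) : (complete k l).edges.Nonempty :=
  Finset.powersetCard_nonempty.mpr (by simpa using h)

/-- Averaging over all `(r + 2)`-tuples bounds the density of `K_{r+2}`-free graphs away from
`1`. -/
theorem turanDensity_complete_lt_one (hr : 1 ≤ r) :
    (complete (r + 1) (r + 2)).turanDensity < 1 := by
  have hle : (complete (r + 1) (r + 2)).turanDensity ≤ (r + 1) / (r + 2) := by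
    refine turanDensity_le_of_forall (complete_edges_nonempty (by omega)) fun n hn H hH => ?_
    have hw1 := sum_uniform hn
    have hpt : ∀ f : Fin (r + 2) → Fin n,
        ∑ i : Fin (r + 2), (if Finset.univ.image (f ∘ i.succAbove) ∈ H.edges then (1 : ℝ) else 0) ≤
          r + 1 := by
      intro f
      obtain ⟨T, -, hT, hTH⟩ := free_complete_iff.mp (hH.comap (exists_edge_complete hr) f)
        Finset.univ (by simp)
      have hTH' : T.image f ∉ H.edges := fun h => hTH (mem_comap.mpr ⟨hT, h⟩)
      obtain ⟨i, hi⟩ : ∃ i, i ∉ T := by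
        by_contra! hall
        rw [Finset.eq_univ_of_forall hall] at hT
        simp at hT
      have hTi : T = Finset.univ.image i.succAbove := by
        refine Finset.eq_of_subset_of_card_le (fun x hx => ?_) ?_
        · obtain ⟨j, hj⟩ := Fin.exists_succAbove_eq (x := x) (y := i) (by rintro rfl; exact hi hx)
          exact hj ▸ Finset.mem_image_of_mem _ (Finset.mem_univ j)
        · rw [Finset.card_image_of_injective _ Fin.succAbove_right_injective, hT]
          simp
      rw [hTi, Finset.image_image] at hTH'
      rw [← Finset.add_sum_erase _ _ (Finset.mem_univ i), if_neg hTH', zero_add]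
      calc _ ≤ ∑ _j ∈ Finset.univ.erase i, (1 : ℝ) :=
            Finset.sum_le_sum fun j _ => by split_ifs <;> simp
        _ = r + 1 := by simp [Finset.card_erase_of_mem]
    have h := tupleMean_mono (fun _ => by positivity : ∀ _ : Fin n, (0 : ℝ) ≤ (n : ℝ)⁻¹) hpt
    rw [tupleMean_const hw1, tupleMean_sum, Finset.sum_congr rfl fun i _ =>
      tupleMean_comp (ι := Fin (r + 1)) hw1 (Fin.succAbove_right_injective (p := i))
        (fun f => if Finset.univ.image f ∈ H.edges then (1 : ℝ) else 0)] at h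
    rw [Finset.sum_const, nsmul_eq_mul, Finset.card_univ, Fintype.card_fin] at h
    push_cast at h
    rw [le_div_iff₀ (by positivity), mul_comm, ← one_add_one_eq_two, ← add_assoc]
    exact h
  refine hle.trans_lt ?_
  rw [div_lt_one (by positivity)]
  linarith

/-- If all large nearly extremal `K_{k+1}`-free graphs admit, on three clones of each vertex, an
admissible link of density at least `π(K_{k+1}) + δ` up to a small error, then `π(K_{k+1})` is
less than the density of `K_{k+2}` minus an edge. -/
theorem turanDensity_lt_of_links (hr : 2 ≤ r) {e : Finset (Fin (r + 3))} (he : e.card = r + 1)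
    {q : Fin 3 → ℝ} (hq : ∀ c, 0 ≤ q c) (hq1 : ∑ c, q c = 1) {δ : ℝ} (hδ : 0 < δ)
    (h : ∀ η > 0, ∀ᶠ n : ℕ in atTop, ∀ H : KGraph (r + 1) (Fin n),
      H.Free (complete (r + 1) (r + 2)) →
      (complete (r + 1) (r + 2)).turanDensity - η ≤
        tupleDensity (r + 1) H.edges (fun _ => (n : ℝ)⁻¹) →
      ∃ L : KGraph r (Fin n × Fin 3),
        (∀ S D : Finset (Fin n × Fin 3), S.card = r + 2 →
          (∀ A ⊆ S, A.card = r → A ∈ L.edges) → ∃ T ⊆ S, T.card = r + 1 ∧ T ≠ D ∧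
            T ∉ (H.comap (Prod.fst : Fin n × Fin 3 → Fin n)).edges) ∧
        (complete (r + 1) (r + 2)).turanDensity + δ - η ≤
          tupleDensity r L.edges (fun x => (n : ℝ)⁻¹ * q x.2)) :
    (complete (r + 1) (r + 2)).turanDensity <
      ((complete (r + 1) (r + 3)).deleteEdge e).turanDensity := by
  refine lt_of_mix_le (by omega : 1 ≤ r) (turanDensity_nonneg _) hδ fun η hη => ?_
  have hlim := (tendsto_ex_div_pow (complete (r + 1) (r + 2))).eventually
    (le_mem_nhds (sub_lt_self _ hη))
  obtain ⟨n, hn, hnη, hn0⟩ := ((h η hη).and (hlim.and (eventually_gt_atTop 0))).exists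
  obtain ⟨H, hH, hHc⟩ := exists_card_eq_ex n
    (complete_edges_nonempty (by omega : r + 1 ≤ r + 2))
  rw [← hHc, ← tupleDensity_uniform] at hnη
  obtain ⟨L, hL, hLd⟩ := hn H hH hnη
  refine ⟨_, _, hnη, hLd, fun ε h0 h1 => ?_⟩
  have hw1 : ∑ x : Fin n × Fin 3, (n : ℝ)⁻¹ * q x.2 = 1 := by
    rw [Fintype.sum_prod_type]
    simp only [← Finset.mul_sum, hq1, mul_one]
    exact sum_uniform hn0
  rw [← tupleDensity_comap_fst H _ hq1]
  exact mix_le_turanDensity hr (hH.comap (exists_edge_complete (by omega)) _) hL he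
    (fun x => mul_nonneg (by positivity) (hq _)) hw1 h0 h1

/-- With colour weights `b²`, `b` and `1 - b - b²`, the gain of the modified link has order `b³`
and its loss has order `b⁴`. -/
theorem exists_colour_weights (r : ℕ) {p : ℝ} (hp0 : 0 ≤ p) (hp1 : p < 1) :
    ∃ q : Fin 3 → ℝ, (∀ c, 0 ≤ q c) ∧ ∑ c, q c = 1 ∧ ∃ g l : ℝ,
      g = q 0 * q 1 * q 2 ^ r ∧ l = (r + 2) ^ 2 * q 0 ^ 2 + (r + 2) ^ 3 * (q 0 * q 1 ^ 2) ∧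
      0 ≤ g ∧ 0 ≤ l ∧ l + g ≤ 1 ∧ 0 < g * (1 - p) - l * p := by
  set M : ℝ := (r + 2) ^ 2 + (r + 2) ^ 3 with hM
  have hM1 : 1 ≤ M := by
    have : (0 : ℝ) ≤ r := by positivity
    nlinarith [pow_nonneg this 2, pow_nonneg this 3]
  obtain ⟨h2, hh2⟩ : ∃ h2 : ℝ, h2 = (1 / 2) ^ r := ⟨_, rfl⟩
  have h20 : 0 < h2 := by rw [hh2]; positivity
  have h21 : h2 ≤ 1 := hh2 ▸ pow_le_one₀ (by norm_num) (by norm_num)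
  have hp1' : 0 < 1 - p := by linarith
  obtain ⟨b, hb⟩ : ∃ b : ℝ, b = h2 * (1 - p) / (4 * M) := ⟨_, rfl⟩
  have hb0 : 0 < b := by rw [hb]; positivity
  have hbM : b * M = h2 * (1 - p) / 4 := by rw [hb]; field_simp
  have hprod : h2 * (1 - p) ≤ 1 := by nlinarith
  have hb4 : b ≤ 1 / 4 := by nlinarith
  have hq2 : 1 / 2 ≤ 1 - b - b ^ 2 := by nlinarith
  have hb3 : b ^ 3 ≤ 1 / 4 := by nlinarith [sq_nonneg b]
  have hb30 : 0 < b ^ 3 := by positivity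
  refine ⟨![b ^ 2, b, 1 - b - b ^ 2], ?_, ?_, b ^ 3 * (1 - b - b ^ 2) ^ r, b ^ 3 * (b * M),
    ?_, ?_, ?_, ?_, ?_, ?_⟩
  · intro c
    fin_cases c
    · exact sq_nonneg b
    · exact hb0.le
    · change 0 ≤ 1 - b - b ^ 2
      linarith
  · simp [Fin.sum_univ_three]
    ring
  · simp only [Matrix.cons_val_zero, Matrix.cons_val_one, Matrix.cons_val]
    ring
  · simp only [hM, Matrix.cons_val_zero, Matrix.cons_val_one]
    ring
  · exact mul_nonneg hb30.le (pow_nonneg (by linarith) _)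
  · positivity
  · have hg : b ^ 3 * (1 - b - b ^ 2) ^ r ≤ b ^ 3 :=
      mul_le_of_le_one_right hb30.le (pow_le_one₀ (by linarith) (by nlinarith))
    rw [hbM]
    nlinarith
  · have hg : b ^ 3 * h2 ≤ b ^ 3 * (1 - b - b ^ 2) ^ r := by
      rw [hh2]
      exact mul_le_mul_of_nonneg_left (pow_le_pow_left₀ (by norm_num) hq2 _) hb30.le
    have h1 := mul_le_mul_of_nonneg_right hg hp1'.le
    have h2' : b ^ 3 * (b * M) * p ≤ b ^ 3 * (b * M) * 1 :=
      mul_le_mul_of_nonneg_left hp1.le (by positivity)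
    have h3 : b ^ 3 * (b * M) = b ^ 3 * (h2 * (1 - p)) / 4 := by rw [hbM]; ring
    have h4 : 0 < b ^ 3 * (h2 * (1 - p)) := by positivity
    linarith

/-- For `k = r + 1 ≥ 4` the modified link of a vertex of at least average degree works. -/
theorem turanDensity_lt_of_three_le (hr : 3 ≤ r) {e : Finset (Fin (r + 3))}
    (he : e.card = r + 1) :
    (complete (r + 1) (r + 2)).turanDensity <
      ((complete (r + 1) (r + 3)).deleteEdge e).turanDensity := by
  obtain ⟨s, rfl⟩ : ∃ s, r = s + 2 := ⟨r - 2, by omega⟩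
  obtain ⟨q, hq, hq1, g, l, hg, hl, hg0, hl0, hgl, hδ⟩ := exists_colour_weights s
    (turanDensity_nonneg (complete (s + 2 + 1) (s + 2 + 2)))
    (turanDensity_complete_lt_one (r := s + 2) (by omega))
  refine turanDensity_lt_of_links (by omega) he hq hq1 hδ fun η hη => ?_
  have hlim := (tendsto_descFactorial_div_pow (s + 2)).eventually
    (le_mem_nhds (sub_lt_self (1 : ℝ) hη))
  filter_upwards [hlim, eventually_gt_atTop 0] with n hn hn0 H hH hHd
  obtain ⟨v, hv⟩ := H.exists_tupleDensity_le_link (fun _ => by positivity) (sum_uniform hn0)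
  refine ⟨H.modifiedLink v, modifiedLink_valid hr hH v, ?_⟩
  refine le_trans ?_ (le_tupleDensity_modifiedLink H v (w := fun _ => (n : ℝ)⁻¹)
    (fun _ => by positivity) hq hq1)
  rw [tupleMean_injective_uniform, ← hl, ← hg]
  have k1 := mul_le_mul_of_nonneg_left (hHd.trans hv) (by linarith : 0 ≤ 1 - l - g)
  have k2 := mul_le_mul_of_nonneg_left hn hg0
  have k3 : 0 ≤ l * η := by positivity
  linarith

end KGraph

/-! ### The Turán density of `K_4^{(3)}` is less than `2 / 3` -/

/-- Five numbers `i ≤ 3` with even sum `2 e`, the edge counts of the `4`-subsets of a `5`-set with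
`e` edges: `e ≤ 7`, and `e = 7` forces some `i ∈ {1, 2}`, which contributes `i (3 - i) = 2`, since `14` is not divisible by `3`. -/
theorem two_mul_le_of_le_three {i j k l m e : ℕ} (hi : i ≤ 3) (hj : j ≤ 3) (hk : k ≤ 3)
    (hl : l ≤ 3) (hm : m ≤ 3) (h : i + j + k + l + m = 2 * e) :
    2 * e ≤ 12 + i * (3 - i) + j * (3 - j) + k * (3 - k) + l * (3 - l) + m * (3 - m) := by
  have key : ∀ x : ℕ, x ≤ 3 → ((x = 0 ∨ x = 3) ∧ x * (3 - x) = 0) ∨ x * (3 - x) = 2 := by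
    intro x hx
    interval_cases x <;> simp
  have h1 := key i hi
  have h2 := key j hj
  have h3 := key k hk
  have h4 := key l hl
  have h5 := key m hm
  generalize i * (3 - i) = a at *
  generalize j * (3 - j) = b at *
  generalize k * (3 - k) = c at *
  generalize l * (3 - l) = d at *
  generalize m * (3 - m) = f at *
  omega

namespace KGraph

variable {V : Type*}

/-- The indicator of the edges of a `3`-graph, as a function of three vertices. -/
def ind [DecidableEq V] (H : KGraph 3 V) (x y z : V) : ℕ := if {x, y, z} ∈ H.edges then 1 else 0

/-- The number of edges among the four triples of entries of `(a, b, c, d)`, counted by position: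
repeated vertices are allowed. -/
def indSum [DecidableEq V] (H : KGraph 3 V) (a b c d : V) : ℕ :=
  H.ind a b c + H.ind a b d + H.ind a c d + H.ind b c d

theorem ind_congr [DecidableEq V] (H : KGraph 3 V) {x y z x' y' z' : V}
    (h : ({x, y, z} : Finset V) = {x', y', z'}) : H.ind x y z = H.ind x' y' z' := by
  rw [ind, ind, h]

theorem ind_rotate [DecidableEq V] (H : KGraph 3 V) (x y z : V) : H.ind y z x = H.ind x y z :=
  H.ind_congr (by ext; simp; tauto)

theorem ind_swap [DecidableEq V] (H : KGraph 3 V) (x y z : V) : H.ind x z y = H.ind x y z :=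
  H.ind_congr (by ext; simp; tauto)

theorem ind_mul_self [DecidableEq V] (H : KGraph 3 V) (x y z : V) :
    (H.ind x y z : ℝ) * H.ind x y z = H.ind x y z := by
  unfold ind
  split_ifs <;> simp

theorem indSum_le [DecidableEq V] {H : KGraph 3 V} (hH : H.Free (complete 3 4)) (a b c d : V) :
    H.indSum a b c d ≤ 3 := by
  have hle : ∀ x y z, H.ind x y z ≤ 1 := fun x y z => by unfold ind; split_ifs <;> simp
  have hpos : ∀ x y z, H.ind x y z ≠ 0 → {x, y, z} ∈ H.edges := by
    intro x y z h
    by_contra hn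
    exact h (if_neg hn)
  have h1 := hle a b c
  have h2 := hle a b d
  have h3 := hle a c d
  have h4 := hle b c d
  by_contra hlt
  unfold indSum at hlt
  have e1 := hpos a b c (by omega)
  have e2 := hpos a b d (by omega)
  have e3 := hpos a c d (by omega)
  have e4 := hpos b c d (by omega)
  obtain ⟨T, -, hT, hTH⟩ := free_complete_iff.mp
    (hH.comap (exists_edge_complete (r := 2) (by omega)) ![a, b, c, d]) Finset.univ (by simp)
  refine hTH (mem_comap.mpr ⟨hT, ?_⟩)
  have hT' : ∀ T : Finset (Fin 4), T.card = 3 →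
      T = {0, 1, 2} ∨ T = {0, 1, 3} ∨ T = {0, 2, 3} ∨ T = {1, 2, 3} := by decide
  rcases hT' T hT with rfl | rfl | rfl | rfl <;> simpa [Finset.image_insert]

theorem tupleDensity_eq_ind [Fintype V] [DecidableEq V] (H : KGraph 3 V) (w : V → ℝ) :
    tupleDensity 3 H.edges w =
      tupleMean w fun f : Fin 3 → V => (H.ind (f 0) (f 1) (f 2) : ℝ) := by
  unfold tupleDensity
  congr 1
  ext f
  have : Finset.univ.image f = {f 0, f 1, f 2} := by
    ext x
    simp [Fin.exists_fin_succ, eq_comm]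
  rw [this, ind]
  push_cast
  rfl

/-- Counting edges in random `5`-tuples and pairs of edges with two common vertices in random
`4`-tuples gives `3 t ^ 2 ≤ t + 3 / 5` for the density `t` of a `K_4`-free `3`-graph. Tuples with
repeated entries cause no error terms, as `indSum_le` holds for them too. -/
theorem tupleDensity_three_le [Fintype V] [DecidableEq V] {H : KGraph 3 V}
    (hH : H.Free (complete 3 4)) {w : V → ℝ} (hw : ∀ u, 0 ≤ w u) (hw1 : ∑ u, w u = 1) :
    tupleDensity 3 H.edges w ≤ 13 / 20 := by
  set t := tupleDensity 3 H.edges w with ht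
  set c := tupleMean w fun f : Fin 4 → V =>
    (H.ind (f 0) (f 1) (f 2) : ℝ) * H.ind (f 0) (f 1) (f 3) with hc
  -- Cauchy-Schwarz for the codegrees of pairs.
  have hct : t ^ 2 ≤ c := by
    have h1 : t = tupleMean w fun f : Fin 2 → V => ∑ u, w u * (H.ind (f 0) (f 1) u : ℝ) := by
      rw [ht, tupleDensity_eq_ind, tupleMean_snoc]
      rfl
    have h2 : c = tupleMean w fun f : Fin 2 → V =>
        (∑ u, w u * (H.ind (f 0) (f 1) u : ℝ)) ^ 2 := by
      rw [hc, tupleMean_snoc, tupleMean_snoc]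
      congr 1
      ext f
      rw [sq, Finset.sum_mul]
      refine Finset.sum_congr rfl fun u _ => ?_
      rw [mul_assoc]
      congr 1
      rw [Finset.mul_sum]
      refine Finset.sum_congr rfl fun x _ => ?_
      rw [mul_left_comm]
      rfl
    rw [h1, h2]
    exact sq_tupleMean_le hw hw1 _
  have hind : ∀ {m : ℕ} (σ : Fin 3 → Fin m), Function.Injective σ →
      (tupleMean w fun f : Fin m → V => (H.ind (f (σ 0)) (f (σ 1)) (f (σ 2)) : ℝ)) = t := by
    intro m σ hσ
    rw [ht, tupleDensity_eq_ind]
    exact tupleMean_comp hw1 hσ fun f : Fin 3 → V => (H.ind (f 0) (f 1) (f 2) : ℝ)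
  have hpair : ∀ (σ : Fin 4 → Fin 4), Function.Injective σ →
      (tupleMean w fun f : Fin 4 → V =>
        (H.ind (f (σ 0)) (f (σ 1)) (f (σ 2)) : ℝ) * H.ind (f (σ 0)) (f (σ 1)) (f (σ 3))) = c := by
    intro σ hσ
    exact tupleMean_comp hw1 hσ fun f : Fin 4 → V =>
      (H.ind (f 0) (f 1) (f 2) : ℝ) * H.ind (f 0) (f 1) (f 3)
  -- The mean of `i (3 - i)`, for the number `i` of edges in a random `4`-tuple.
  have hfour : (tupleMean w fun f : Fin 4 → V =>
      (H.indSum (f 0) (f 1) (f 2) (f 3) : ℝ) * (3 - H.indSum (f 0) (f 1) (f 2) (f 3))) =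
      8 * t - 12 * c := by
    have hexp : ∀ f : Fin 4 → V,
        (H.indSum (f 0) (f 1) (f 2) (f 3) : ℝ) * (3 - H.indSum (f 0) (f 1) (f 2) (f 3)) =
        2 * ((H.ind (f 0) (f 1) (f 2) : ℝ) + H.ind (f 0) (f 1) (f 3) + H.ind (f 0) (f 2) (f 3) +
          H.ind (f 1) (f 2) (f 3)) -
        2 * ((H.ind (f 0) (f 1) (f 2) : ℝ) * H.ind (f 0) (f 1) (f 3) +
          (H.ind (f 0) (f 2) (f 1) : ℝ) * H.ind (f 0) (f 2) (f 3) +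
          (H.ind (f 1) (f 2) (f 0) : ℝ) * H.ind (f 1) (f 2) (f 3) +
          (H.ind (f 0) (f 3) (f 1) : ℝ) * H.ind (f 0) (f 3) (f 2) +
          (H.ind (f 1) (f 3) (f 0) : ℝ) * H.ind (f 1) (f 3) (f 2) +
          (H.ind (f 2) (f 3) (f 0) : ℝ) * H.ind (f 2) (f 3) (f 1)) := by
      intro f
      have s1 : H.ind (f 0) (f 2) (f 1) = H.ind (f 0) (f 1) (f 2) := H.ind_swap _ _ _
      have s2 : H.ind (f 1) (f 2) (f 0) = H.ind (f 0) (f 1) (f 2) := H.ind_rotate _ _ _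
      have s3 : H.ind (f 0) (f 3) (f 1) = H.ind (f 0) (f 1) (f 3) := H.ind_swap _ _ _
      have s4 : H.ind (f 0) (f 3) (f 2) = H.ind (f 0) (f 2) (f 3) := H.ind_swap _ _ _
      have s5 : H.ind (f 1) (f 3) (f 0) = H.ind (f 0) (f 1) (f 3) := H.ind_rotate _ _ _
      have s6 : H.ind (f 1) (f 3) (f 2) = H.ind (f 1) (f 2) (f 3) := H.ind_swap _ _ _
      have s7 : H.ind (f 2) (f 3) (f 0) = H.ind (f 0) (f 2) (f 3) := H.ind_rotate _ _ _
      have s8 : H.ind (f 2) (f 3) (f 1) = H.ind (f 1) (f 2) (f 3) := H.ind_rotate _ _ _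
      rw [s1, s2, s3, s4, s5, s6, s7, s8, indSum]
      push_cast
      linear_combination -(H.ind_mul_self (f 0) (f 1) (f 2)) - H.ind_mul_self (f 0) (f 1) (f 3) -
        H.ind_mul_self (f 0) (f 2) (f 3) - H.ind_mul_self (f 1) (f 2) (f 3)
    have a0 : (tupleMean w fun f : Fin 4 → V => (H.ind (f 0) (f 1) (f 2) : ℝ)) = t :=
      hind ![0, 1, 2] (by decide)
    have a1 : (tupleMean w fun f : Fin 4 → V => (H.ind (f 0) (f 1) (f 3) : ℝ)) = t :=
      hind ![0, 1, 3] (by decide)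
    have a2 : (tupleMean w fun f : Fin 4 → V => (H.ind (f 0) (f 2) (f 3) : ℝ)) = t :=
      hind ![0, 2, 3] (by decide)
    have a3 : (tupleMean w fun f : Fin 4 → V => (H.ind (f 1) (f 2) (f 3) : ℝ)) = t :=
      hind ![1, 2, 3] (by decide)
    have b0 : (tupleMean w fun f : Fin 4 → V =>
        (H.ind (f 0) (f 1) (f 2) : ℝ) * H.ind (f 0) (f 1) (f 3)) = c :=
      hpair ![0, 1, 2, 3] (by decide)
    have b1 : (tupleMean w fun f : Fin 4 → V =>
        (H.ind (f 0) (f 2) (f 1) : ℝ) * H.ind (f 0) (f 2) (f 3)) = c :=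
      hpair ![0, 2, 1, 3] (by decide)
    have b2 : (tupleMean w fun f : Fin 4 → V =>
        (H.ind (f 1) (f 2) (f 0) : ℝ) * H.ind (f 1) (f 2) (f 3)) = c :=
      hpair ![1, 2, 0, 3] (by decide)
    have b3 : (tupleMean w fun f : Fin 4 → V =>
        (H.ind (f 0) (f 3) (f 1) : ℝ) * H.ind (f 0) (f 3) (f 2)) = c :=
      hpair ![0, 3, 1, 2] (by decide)
    have b4 : (tupleMean w fun f : Fin 4 → V =>
        (H.ind (f 1) (f 3) (f 0) : ℝ) * H.ind (f 1) (f 3) (f 2)) = c :=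
      hpair ![1, 3, 0, 2] (by decide)
    have b5 : (tupleMean w fun f : Fin 4 → V =>
        (H.ind (f 2) (f 3) (f 0) : ℝ) * H.ind (f 2) (f 3) (f 1)) = c :=
      hpair ![2, 3, 0, 1] (by decide)
    simp only [hexp, tupleMean_sub, tupleMean_const_mul, tupleMean_add, a0, a1, a2, a3, b0, b1, b2,
      b3, b4, b5]
    ring
  have hquad : ∀ (σ : Fin 4 → Fin 5), Function.Injective σ →
      (tupleMean w fun f : Fin 5 → V => (H.indSum (f (σ 0)) (f (σ 1)) (f (σ 2)) (f (σ 3)) : ℝ) *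
        (3 - H.indSum (f (σ 0)) (f (σ 1)) (f (σ 2)) (f (σ 3)))) = 8 * t - 12 * c := by
    intro σ hσ
    rw [← hfour]
    exact tupleMean_comp hw1 hσ fun f : Fin 4 → V =>
      (H.indSum (f 0) (f 1) (f 2) (f 3) : ℝ) * (3 - H.indSum (f 0) (f 1) (f 2) (f 3))
  -- The mean of this inequality is `20 t ≤ 12 + 5 (8 t - 12 c)`.
  have hpt : ∀ f : Fin 5 → V,
      2 * ((H.ind (f 0) (f 1) (f 2) : ℝ) +
        (H.ind (f 0) (f 1) (f 3) : ℝ) +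
        (H.ind (f 0) (f 1) (f 4) : ℝ) +
        (H.ind (f 0) (f 2) (f 3) : ℝ) +
        (H.ind (f 0) (f 2) (f 4) : ℝ) +
        (H.ind (f 0) (f 3) (f 4) : ℝ) +
        (H.ind (f 1) (f 2) (f 3) : ℝ) +
        (H.ind (f 1) (f 2) (f 4) : ℝ) +
        (H.ind (f 1) (f 3) (f 4) : ℝ) +
        (H.ind (f 2) (f 3) (f 4) : ℝ)) ≤
      12 + ((H.indSum (f 0) (f 1) (f 2) (f 3) : ℝ) *
          (3 - H.indSum (f 0) (f 1) (f 2) (f 3)) +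
        (H.indSum (f 0) (f 1) (f 2) (f 4) : ℝ) *
          (3 - H.indSum (f 0) (f 1) (f 2) (f 4)) +
        (H.indSum (f 0) (f 1) (f 3) (f 4) : ℝ) *
          (3 - H.indSum (f 0) (f 1) (f 3) (f 4)) +
        (H.indSum (f 0) (f 2) (f 3) (f 4) : ℝ) *
          (3 - H.indSum (f 0) (f 2) (f 3) (f 4)) +
        (H.indSum (f 1) (f 2) (f 3) (f 4) : ℝ) *
          (3 - H.indSum (f 1) (f 2) (f 3) (f 4))) := by
    intro f
    have h3 : ∀ a b d e, (3 - H.indSum a b d e : ℝ) = ((3 - H.indSum a b d e : ℕ) : ℝ) :=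
      fun a b d e => by rw [Nat.cast_sub (indSum_le hH a b d e)]; norm_num
    simp only [h3]
    have h := two_mul_le_of_le_three (indSum_le hH (f 0) (f 1) (f 2) (f 3)) (indSum_le hH (f 0) (f 1) (f 2) (f 4)) (indSum_le hH (f 0) (f 1) (f 3) (f 4)) (indSum_le hH (f 0) (f 2) (f 3) (f 4)) (indSum_le hH (f 1) (f 2) (f 3) (f 4))
      (e := H.ind (f 0) (f 1) (f 2) + H.ind (f 0) (f 1) (f 3) + H.ind (f 0) (f 1) (f 4) + H.ind (f 0) (f 2) (f 3) + H.ind (f 0) (f 2) (f 4) + H.ind (f 0) (f 3) (f 4) + H.ind (f 1) (f 2) (f 3) + H.ind (f 1) (f 2) (f 4) + H.ind (f 1) (f 3) (f 4) + H.ind (f 2) (f 3) (f 4))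
      (by unfold indSum; ring)
    have h' := (Nat.cast_le (α := ℝ)).mpr h
    simp only [Nat.cast_add, Nat.cast_mul, Nat.cast_ofNat] at h'
    linarith
  have h := tupleMean_mono hw hpt
  have a0 : (tupleMean w fun f : Fin 5 → V => (H.ind (f 0) (f 1) (f 2) : ℝ)) = t :=
    hind ![0, 1, 2] (by decide)
  have a1 : (tupleMean w fun f : Fin 5 → V => (H.ind (f 0) (f 1) (f 3) : ℝ)) = t :=
    hind ![0, 1, 3] (by decide)
  have a2 : (tupleMean w fun f : Fin 5 → V => (H.ind (f 0) (f 1) (f 4) : ℝ)) = t :=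
    hind ![0, 1, 4] (by decide)
  have a3 : (tupleMean w fun f : Fin 5 → V => (H.ind (f 0) (f 2) (f 3) : ℝ)) = t :=
    hind ![0, 2, 3] (by decide)
  have a4 : (tupleMean w fun f : Fin 5 → V => (H.ind (f 0) (f 2) (f 4) : ℝ)) = t :=
    hind ![0, 2, 4] (by decide)
  have a5 : (tupleMean w fun f : Fin 5 → V => (H.ind (f 0) (f 3) (f 4) : ℝ)) = t :=
    hind ![0, 3, 4] (by decide)
  have a6 : (tupleMean w fun f : Fin 5 → V => (H.ind (f 1) (f 2) (f 3) : ℝ)) = t :=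
    hind ![1, 2, 3] (by decide)
  have a7 : (tupleMean w fun f : Fin 5 → V => (H.ind (f 1) (f 2) (f 4) : ℝ)) = t :=
    hind ![1, 2, 4] (by decide)
  have a8 : (tupleMean w fun f : Fin 5 → V => (H.ind (f 1) (f 3) (f 4) : ℝ)) = t :=
    hind ![1, 3, 4] (by decide)
  have a9 : (tupleMean w fun f : Fin 5 → V => (H.ind (f 2) (f 3) (f 4) : ℝ)) = t :=
    hind ![2, 3, 4] (by decide)
  have b0 : (tupleMean w fun f : Fin 5 → V => (H.indSum (f 0) (f 1) (f 2) (f 3) : ℝ) *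
      (3 - H.indSum (f 0) (f 1) (f 2) (f 3))) = 8 * t - 12 * c :=
    hquad ![0, 1, 2, 3] (by decide)
  have b1 : (tupleMean w fun f : Fin 5 → V => (H.indSum (f 0) (f 1) (f 2) (f 4) : ℝ) *
      (3 - H.indSum (f 0) (f 1) (f 2) (f 4))) = 8 * t - 12 * c :=
    hquad ![0, 1, 2, 4] (by decide)
  have b2 : (tupleMean w fun f : Fin 5 → V => (H.indSum (f 0) (f 1) (f 3) (f 4) : ℝ) *
      (3 - H.indSum (f 0) (f 1) (f 3) (f 4))) = 8 * t - 12 * c :=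
    hquad ![0, 1, 3, 4] (by decide)
  have b3 : (tupleMean w fun f : Fin 5 → V => (H.indSum (f 0) (f 2) (f 3) (f 4) : ℝ) *
      (3 - H.indSum (f 0) (f 2) (f 3) (f 4))) = 8 * t - 12 * c :=
    hquad ![0, 2, 3, 4] (by decide)
  have b4 : (tupleMean w fun f : Fin 5 → V => (H.indSum (f 1) (f 2) (f 3) (f 4) : ℝ) *
      (3 - H.indSum (f 1) (f 2) (f 3) (f 4))) = 8 * t - 12 * c :=
    hquad ![1, 2, 3, 4] (by decide)
  simp only [tupleMean_const_mul, tupleMean_add, tupleMean_const hw1, a0, a1, a2, a3, a4, a5, a6, a7, a8, a9,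
    b0, b1, b2, b3, b4] at h
  nlinarith

/-! ### Three-uniform graphs: the tripartite link -/

/-- The complete tripartite graph on three clones of each vertex: pairs of clones of different
colours, two clones of one vertex included. -/
def tripartite (V : Type*) [Fintype V] [DecidableEq V] : KGraph 2 (V × Fin 3) where
  edges := Finset.univ.filter fun A => A.card = 2 ∧ Set.InjOn Prod.snd (A : Set (V × Fin 3))
  card_eq := fun _ he => (Finset.mem_filter.mp he).2.1

theorem tupleDensity_tripartite [Fintype V] [DecidableEq V] {w : V → ℝ} (hw1 : ∑ u, w u = 1) :
    tupleDensity 2 (tripartite V).edges (fun x => w x.1 * 3⁻¹) = 2 / 3 := by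
  rw [tupleDensity, tupleMean_prod w (fun _ => (3 : ℝ)⁻¹),
    ← tupleMean_const (ι := Fin 2) hw1 (2 / 3)]
  congr 1
  ext u
  have h : ∀ c : Fin 2 → Fin 3,
      (Finset.univ.image fun i => (u i, c i)) ∈ (tripartite V).edges ↔ c 0 ≠ c 1 := by
    intro c
    have himage : (Finset.univ.image fun i => (u i, c i)) = {(u 0, c 0), (u 1, c 1)} := by
      ext x
      simp [Fin.exists_fin_two, eq_comm]
    rw [himage]
    simp only [tripartite, Finset.mem_filter, Finset.mem_univ, true_and]
    constructor
    · rintro ⟨hc, hinj⟩ heq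
      have h01 := hinj (x₁ := (u 0, c 0)) (by simp) (x₂ := (u 1, c 1)) (by simp) heq
      rw [h01] at hc
      simp at hc
    · intro hne
      refine ⟨Finset.card_pair fun h => hne (congrArg Prod.snd h), ?_⟩
      intro x hx y hy hxy
      simp only [Finset.coe_insert, Finset.coe_singleton, Set.mem_insert_iff,
        Set.mem_singleton_iff] at hx hy
      rcases hx with rfl | rfl <;> rcases hy with rfl | rfl
      · rfl
      · exact absurd hxy hne
      · exact absurd hxy.symm hne
      · rfl
  simp only [h, tupleMean, Finset.prod_const]
  rw [← Finset.mul_sum, Finset.sum_boole]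
  have hcard : (Finset.univ.filter fun c : Fin 2 → Fin 3 => c 0 ≠ c 1).card = 6 := by decide
  rw [hcard]
  norm_num

/-- For `k = 3` the tripartite link works: it is `K_4`-free, and denser than `K_4^{(3)}`-free
`3`-graphs. -/
theorem turanDensity_lt_of_two {e : Finset (Fin 5)} (he : e.card = 3) :
    (complete 3 4).turanDensity < ((complete 3 5).deleteEdge e).turanDensity := by
  have hp : (complete 3 4).turanDensity ≤ 13 / 20 :=
    turanDensity_le_of_forall (complete_edges_nonempty (by omega)) fun n hn H hH =>
      tupleDensity_three_le hH (fun _ => by positivity) (sum_uniform hn)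
  refine turanDensity_lt_of_links (r := 2) le_rfl he (q := fun _ => 3⁻¹) (fun _ => by positivity)
    (by simp) (δ := 1 / 60) (by norm_num) fun η hη => ?_
  filter_upwards [eventually_gt_atTop 0] with n hn H hH hHd
  refine ⟨tripartite (Fin n), fun S D hS hA => ?_, ?_⟩
  · -- Two of four vertices have the same colour.
    exfalso
    obtain ⟨a, ha, b, hb, hab, hcol⟩ := Finset.exists_ne_map_eq_of_card_lt_of_maps_to
      (s := S) (t := (Finset.univ : Finset (Fin 3))) (by rw [hS]; simp) (f := Prod.snd)
      (fun _ _ => Finset.mem_univ _)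
    have hmem := hA {a, b} (by simp [Finset.insert_subset_iff, ha, hb]) (Finset.card_pair hab)
    exact hab ((Finset.mem_filter.mp hmem).2.2 (by simp) (by simp) hcol)
  · rw [tupleDensity_tripartite (sum_uniform hn)]
    change (complete 3 4).turanDensity + 1 / 60 - η ≤ 2 / 3
    linarith

end KGraph

theorem theorem1p2 (k : ℕ) (hk : 3 ≤ k) (e : Finset (Fin (k + 2)))
    (he : e ∈ (KGraph.complete k (k + 2)).edges) :
    (KGraph.complete k (k + 1)).turanDensity <
      ((KGraph.complete k (k + 2)).deleteEdge e).turanDensity := by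
  have hc : e.card = k := KGraph.mem_complete.mp he
  obtain ⟨r, rfl⟩ : ∃ r, k = r + 1 := ⟨k - 1, by omega⟩
  rcases Nat.lt_or_ge r 3 with h | h
  · obtain rfl : r = 2 := by omega
    exact KGraph.turanDensity_lt_of_two hc
  · exact KGraph.turanDensity_lt_of_three_le h hc
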